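/- Consider functions of $n\in\mathbb Z$ and of the times $t=(t_1,t_2,\dots)\in U$ with values in $\mathbb R$ or $\mathbb C$, where $U\subseteq\mathbb R^{\{1,2,\dots\}}$ is open in every finite set of coordinate directions; all functions are assumed to be $C^\infty$ in any finitely many of the times. Let $\Delta g(n)=g(n+1)-g(n)$, $\xi(t,\lambda)=\sum_{i\ge1}t_i\lambda^i$ and $[s]=(s,s^2/2,s^3/3,\dots)$; a shift by $\pm[s]$ denotes the formal Taylor expansion $f(n,t\pm[s])=\exp\bigl(\pm\sum_{i\ge1}\frac{s^i}{i}\partial_{t_i}\bigr)f(n,t)$, a formal power series in $s$. Pseudo-difference operators $\sum_{k\ll\infty}u_k(n,t)\Delta^k$ are multiplied by the rule $\Delta^k\circ g=\sum_{l\ge0}\binom kl(\Delta^l g)(n+k-l)\Delta^{k-l}$, $k\in\mathbb Z$. Let $Z=z_0+z_1\Delta^{-1}+z_2\Delta^{-2}+\cdots$, with $z_0$ nowhere zero, be a dressing operator of the discrete modified KP hierarchy: with $L=Z\Delta Z^{-1}$, it satisfies the Sato equations $$\frac{\partial Z}{\partial t_i}=-(L^i)_{\le0}\,Z,\qquad i=1,2,3,\dots,$$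 where $(\sum_k a_k\Delta^k)_{\le0}=\sum_{k\le0}a_k\Delta^k$. Let $$w(n,t,\lambda)=Z(n)(1+\lambda)^ne^{\xi(t,\lambda)},\qquad w^*(n,t,\lambda)=\bigl(Z^{-1}(n-1)\Delta^{-1}\bigr)^*(1+\lambda)^{-n}e^{-\xi(t,\lambda)}$$ be its wave function and adjoint wave function, where $Z^{-1}(n-1)$ is $Z^{-1}$ with $n$ replaced by $n-1$ in all its coefficients, $(\sum_k a_k\Delta^k)^*=\sum_k(\Delta^*)^k\circ a_k$ and $\Delta^*g(n)=g(n-1)-g(n)$. Let $\tau_0,\tau_1$ be tau functions of this solution, that is, nowhere vanishing functions of $(n,t)$ with $$w(n,t,\lambda)=\frac{\tau_0(n,t-[\lambda^{-1}])}{\tau_1(n,t)}(1+\lambda)^ne^{\xi(t,\lambda)},\qquad w^*(n,t,\lambda)=\frac{\tau_1(n,t+[\lambda^{-1}])}{\tau_0(n,t)}\lambda^{-1}(1+\lambda)^{-n}e^{-\xi(t,\lambda)}.$$ Then each of $\tau_0$ and $\tau_1$ satisfies the difference Fay identity of the discrete KP hierarchy: for $i=0,1$ and all $n\in\mathbb Z$,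 $t\in U$, $$(1+s_3^{-1})\,\Delta\!\left(\frac{\tau_i(n,t+[s_1]-[s_3])}{\tau_i(n,t)}\right)=(s_3^{-1}-s_1^{-1})\left(\frac{\tau_i(n,t-[s_3])\,\tau_i(n+1,t+[s_1])}{\tau_i(n,t)\,\tau_i(n+1,t)}-\frac{\tau_i(n,t+[s_1]-[s_3])}{\tau_i(n,t)}\right),$$ an identity in the field of fractions of the ring of formal power series in the variables $s_1,s_3$. -/

import Mathlib

open scoped ContDiff

noncomputable section

namespace DmKP

/-! ### Functions of the times `t = (t₁, t₂, t₃, …)` -/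

/-- The sequences of real times `(t₁, t₂, …)`. -/
abbrev Times : Type := ℕ+ → ℝ

/-- The displacement that moves only the times with index in the finite set `I`, by `v`. -/
def displacement (I : Finset ℕ+) (v : I → ℝ) : Times :=
  fun i => if h : i ∈ I then v ⟨i, h⟩ else 0

/-- `U` is open in every finite set of coordinate directions.  Examples are all sequences,
the finitely supported sequences, the sequences on which a given family of exponential series
converges, and products of open sets. -/
def IsFinOpen (U : Set Times) : Prop :=
  ∀ t ∈ U, ∀ I : Finset ℕ+, ∀ᶠ v : I → ℝ in nhds 0, t + displacement I v ∈ U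

/-- Extension by zero of a function on `U`; only its values on `U` ever matter below. -/
def extendZero {𝕜 : Type*} [RCLike 𝕜] {U : Set Times} (f : U → 𝕜) (t : Times) : 𝕜 :=
  open Classical in if h : t ∈ U then f ⟨t, h⟩ else 0

/-- `f` is a `C^∞` function of any finitely many of the times, near every point of `U`. -/
def IsSmooth {𝕜 : Type*} [RCLike 𝕜] {U : Set Times} (f : U → 𝕜) : Prop :=
  ∀ t : U, ∀ I : Finset ℕ+,
    ContDiffAt ℝ ∞ (fun v : I → ℝ => extendZero f ((t : Times) + displacement I v)) 0

/-- The partial derivative `∂f/∂tᵢ`. -/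
def pd {𝕜 : Type*} [RCLike 𝕜] {U : Set Times} (i : ℕ+) (f : U → 𝕜) : U → 𝕜 :=
  fun t => deriv (fun x : ℝ => extendZero f ((t : Times) + Pi.single i x)) 0

/-! ### The shifts `t ↦ t + ε[s]`, `[s] = (s, s²/2, s³/3, …)` -/

/-- The operator `∑_{i ≥ 1} (sⁱ/i) ∂/∂tᵢ` on formal power series `∑ₖ fₖ sᵏ` whose coefficients
are functions of `t`; a series is given by its coefficients. -/
def miwaField {𝕜 : Type*} [RCLike 𝕜] {U : Set Times} (f : ℕ → U → 𝕜) : ℕ → U → 𝕜 :=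
  fun k => ∑ i ∈ Finset.range k, ((i + 1 : ℕ) : 𝕜)⁻¹ • pd i.succPNat (f (k - (i + 1)))

/-- The coefficient of `sᵏ` in the formal Taylor expansion
`f(t + ε[s]) = exp(ε ∑_{i ≥ 1} (sⁱ/i) ∂/∂tᵢ) f(t)`.  The `m`-th power of the exponent is divisible
by `sᵐ`, so that only the terms with `m ≤ k` contribute. -/
def miwaCoeff {𝕜 : Type*} [RCLike 𝕜] {U : Set Times} (ε : ℤ) (k : ℕ) (f : U → 𝕜) : U → 𝕜 :=
  ∑ m ∈ Finset.range (k + 1),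
    ((ε : 𝕜) ^ m / (m.factorial : 𝕜)) • (miwaField^[m] (Pi.single 0 f)) k

/-- The field of fractions of the formal power series in `s₁` and `s₃`. -/
abbrev MiwaField (𝕜 : Type*) [RCLike 𝕜] : Type _ := FractionRing (MvPowerSeries (Fin 2) 𝕜)

/-- The formal variable `s₁`. -/
def s₁ (𝕜 : Type*) [RCLike 𝕜] : MiwaField 𝕜 :=
  algebraMap (MvPowerSeries (Fin 2) 𝕜) (MiwaField 𝕜) (MvPowerSeries.X 0)

/-- The formal variable `s₃`. -/
def s₃ (𝕜 : Type*) [RCLike 𝕜] : MiwaField 𝕜 :=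
  algebraMap (MvPowerSeries (Fin 2) 𝕜) (MiwaField 𝕜) (MvPowerSeries.X 1)

/-- `f(n, t + a[s₁] + b[s₃])`, the formal Taylor expansion in `s₁` and `s₃` at the point `t`.
For `a = b = 0` it is the constant `f(n, t)`. -/
def shifted {𝕜 : Type*} [RCLike 𝕜] {U : Set Times} (a b : ℤ) (f : ℤ → U → 𝕜) (t : U) (n : ℤ) :
    MiwaField 𝕜 :=
  algebraMap (MvPowerSeries (Fin 2) 𝕜) (MiwaField 𝕜)
    (fun d : Fin 2 →₀ ℕ => miwaCoeff a (d 0) (miwaCoeff b (d 1) (f n)) t)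

/-! ### Pseudo-difference operators in `n ∈ ℤ`

Below `A` is the ring of functions of `t`, and `ℤ → A` consists of the functions of `(n, t)`.
`fwdDiff 1` is the difference operator `Δ g(n) = g(n+1) - g(n)`. -/

/-- The pseudo-difference operators `∑_{k ≪ ∞} uₖ(n) Δᵏ`. -/
@[ext] structure PsDiff (A : Type*) [CommRing A] where
  coeff : ℤ → ℤ → A
  bounded : ∃ m : ℤ, ∀ k, m < k → coeff k = 0

namespace PsDiff

variable {A : Type*} [CommRing A]

/-- The operator `Δʲ`, `j ∈ ℤ`. -/
def deltaPow (j : ℤ) : PsDiff A where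
  coeff k := if k = j then 1 else 0
  bounded := ⟨j, fun _ hk => if_neg hk.ne'⟩

instance : One (PsDiff A) := ⟨deltaPow 0⟩

/-- The coefficient of `Δᵐ` in the product, from the Leibniz rule
`Δʲ ∘ g = ∑_{l ≥ 0} binom(j, l) (Δˡ g)(n + j - l) Δ^{j-l}`, for all `j ∈ ℤ`.
Only finitely many terms are nonzero. -/
def mulCoeff (a b : PsDiff A) (m : ℤ) : ℤ → A :=
  fun n => ∑ᶠ p : ℤ × ℕ, Ring.choose p.1 p.2 •
    (a.coeff p.1 n * ((fwdDiff (1 : ℤ))^[p.2] (b.coeff (m - p.1 + p.2))) (n + p.1 - p.2))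

theorem fwdDiff_iterate_zero (l : ℕ) :
    (fwdDiff (1 : ℤ))^[l] (0 : ℤ → A) = 0 := by
  induction l with
  | zero => rfl
  | succ l ih =>
    rw [Function.iterate_succ_apply]
    have h : fwdDiff (1 : ℤ) (0 : ℤ → A) = 0 := by
      funext n
      simp [fwdDiff]
    rw [h, ih]

instance : Mul (PsDiff A) where
  mul a b :=
    { coeff := mulCoeff a b
      bounded := by
        obtain ⟨ma, ha⟩ := a.bounded
        obtain ⟨mb, hb⟩ := b.bounded
        refine ⟨ma + mb, fun m hm => funext fun n => ?_⟩
        refine finsum_eq_zero_of_forall_eq_zero fun p => ?_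
        by_cases hp : ma < p.1
        · simp [ha _ hp]
        · have h : mb < m - p.1 + p.2 := by omega
          rw [hb _ h, fwdDiff_iterate_zero]
          simp }

/-- The part `∑_{k ≤ 0} aₖ Δᵏ` of `∑ aₖ Δᵏ`. -/
def nonpos (a : PsDiff A) : PsDiff A where
  coeff k := if k ≤ 0 then a.coeff k else 0
  bounded := ⟨0, fun _ hk => if_neg (not_le.mpr hk)⟩

/-- The operator `a(n + j)`: all coefficients are shifted by `j` in `n`. -/
def translate (j : ℤ) (a : PsDiff A) : PsDiff A where
  coeff k n := a.coeff k (n + j)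
  bounded := by
    obtain ⟨m, hm⟩ := a.bounded
    exact ⟨m, fun k hk => funext fun n => by simp [hm k hk]⟩

/-- The coefficient of `λᵐ` in the formal series `f` for which
`a ((1+λ)ⁿ e^{ξ(t,λ)}) = f(n, t, λ) (1+λ)ⁿ e^{ξ(t,λ)}`.  Here
`Δᵏ ((1+λ)ⁿ e^ξ) = λᵏ (1+λ)ⁿ e^ξ` for all `k ∈ ℤ`. -/
def symbol (a : PsDiff A) (m : ℤ) : ℤ → A := a.coeff m

/-- The adjoint difference operator `Δ* g(n) = (Γ⁻¹ - 1) g(n) = g(n-1) - g(n)`. -/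
def adjDiff (g : ℤ → A) : ℤ → A := fun n => g (n - 1) - g n

/-- The coefficient of `λᵐ` in the formal series `f` for which
`a* ((1+λ)⁻ⁿ e^{-ξ(t,λ)}) = f(n, t, λ) (1+λ)⁻ⁿ e^{-ξ(t,λ)}`, where
`(∑ aₖ Δᵏ)* = ∑ (Δ*)ᵏ ∘ aₖ`.  Because
`Δ* (g (1+λ)⁻ⁿ) = (λ Γ⁻¹ g + Δ* g) (1+λ)⁻ⁿ`, for all `k ∈ ℤ`
`(Δ*)ᵏ (g (1+λ)⁻ⁿ) = ∑_{l ≥ 0} binom(k, l) λ^{k-l} (Γ^{-(k-l)} (Δ*)ˡ g) (1+λ)⁻ⁿ`;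
the terms with `k = m + l` contribute to `λᵐ`. -/
def adjSymbol (a : PsDiff A) (m : ℤ) : ℤ → A :=
  fun n => ∑ᶠ l : ℕ, Ring.choose (m + l) l • (adjDiff^[l] (a.coeff (m + l))) (n - m)

end PsDiff

/-! ### The discrete modified KP hierarchy -/

/-- A solution of the hierarchy on the domain `U` of times, given by its dressing operator
`Z = z₀ + z₁ Δ⁻¹ + z₂ Δ⁻² + ⋯`, with `L = Z Δ Z⁻¹` and the Sato equations
`∂Z/∂tᵢ = -(Lⁱ)_{≤0} Z`, `i = 1, 2, …`.  (They imply the Lax equations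
`∂L/∂tᵢ = [(Lⁱ)_{≥1}, L]`.) -/
structure Solution (𝕜 : Type*) [RCLike 𝕜] (U : Set Times) where
  /-- The dressing operator. -/
  Z : PsDiff (U → 𝕜)
  /-- Its two-sided inverse. -/
  Zinv : PsDiff (U → 𝕜)
  order_le : ∀ k : ℤ, 0 < k → Z.coeff k = 0
  lead_ne_zero : ∀ (n : ℤ) (t : U), Z.coeff 0 n t ≠ 0
  smooth : ∀ k n : ℤ, IsSmooth (Z.coeff k n)
  mul_inv : Z * Zinv = 1
  inv_mul : Zinv * Z = 1
  sato : ∀ (i : ℕ+) (k n : ℤ) (t : U),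
    pd i (Z.coeff k n) t =
      -((npowRec (i : ℕ) (Z * PsDiff.deltaPow 1 * Zinv)).nonpos * Z).coeff k n t

namespace Solution

variable {𝕜 : Type*} [RCLike 𝕜] {U : Set Times} (S : Solution 𝕜 U)

/-- The coefficient of `λᵐ` in `ŵ`, where the wave function is
`w(n,t,λ) = Z(n) (1+λ)ⁿ e^{ξ(t,λ)} = ŵ(n,t,λ) (1+λ)ⁿ e^{ξ(t,λ)}`. -/
def wave (m : ℤ) : ℤ → U → 𝕜 := S.Z.symbol m

/-- The coefficient of `λᵐ` in the factor of `(1+λ)⁻ⁿ e^{-ξ(t,λ)}` in the adjoint wave function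
`w*(n,t,λ) = (Z⁻¹(n-1) Δ⁻¹)* (1+λ)⁻ⁿ e^{-ξ(t,λ)}`. -/
def adjWave (m : ℤ) : ℤ → U → 𝕜 :=
  (S.Zinv.translate (-1) * PsDiff.deltaPow (-1)).adjSymbol m

/-- `τ 0` and `τ 1` are tau functions of the solution: smooth and without zeros, with
`w  = τ₀(n, t - [λ⁻¹]) / τ₁(n, t) · (1+λ)ⁿ e^{ξ(t,λ)}` and
`w* = τ₁(n, t + [λ⁻¹]) / τ₀(n, t) · λ⁻¹ (1+λ)⁻ⁿ e^{-ξ(t,λ)}`,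
compared coefficient by coefficient in the powers `λ⁻ʲ` and `λ⁻¹⁻ʲ`, `j ≥ 0`. (The coefficients of
higher powers of `λ` vanish on both sides.) -/
structure IsTau (τ : Fin 2 → ℤ → U → 𝕜) : Prop where
  smooth : ∀ i n, IsSmooth (τ i n)
  ne_zero : ∀ i n t, τ i n t ≠ 0
  wave_eq : ∀ (j : ℕ) (n : ℤ) (t : U),
    S.wave (-(j : ℤ)) n t = miwaCoeff (-1) j (τ 0 n) t / τ 1 n t
  adjWave_eq : ∀ (j : ℕ) (n : ℤ) (t : U),
    S.adjWave (-1 - (j : ℤ)) n t = miwaCoeff 1 j (τ 1 n) t / τ 0 n t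

end Solution

end DmKP

end

/-! ### Pseudo-difference operators: associativity of the product. -/

noncomputable section

namespace DmKP
namespace PsDiff

variable {A : Type*} [CommRing A]

/-! Write `T f = f(t - [s])`. Since `exp ξ(t - [s], λ) = (1 - sλ) exp ξ(t, λ)`, the shifted wave
function has dressing operator `G = Z(t - [s]) (1 - sΔ)`. The Sato equations give `∂ᵢZ + Z Δⁱ =
(Lⁱ)_{>0} Z`, and they make every coefficient of `G` in `s` beyond the constant one `Z` equal to an
operator with only positive powers of `Δ`, times `Z`. Each such coefficient also has order at most
one, so a single term survives: `Z(t - [s]) (1 - sΔ) = (1 + e Δ) Z` for some function `e(n, t, s)`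
(`exists_shiftedWave_eq_mul`, `exists_shift_eq`).

This is a linear equation for the wave function in `s` and `λ` (`exists_shift_wave_eq`). Its leading
coefficient at `λ = ∞` expresses `e` by tau functions; its restriction to `λ = s⁻¹`, where the left
side vanishes, then gives a bilinear relation between `τ₀` and `τ₁` at neighbouring sites
(`tau_site_relation`). Substitution into the full equation yields the Fay identity for `τ₀` with
both shifts negative (`negFay_zero`). Elimination with the bilinear relation transfers it to `τ₁`
(`tauRelation_of_negFay`, `negFay_one`). Replacing `t` by `t + [s₁]` gives the stated form
(`fay_of_negFay`).

Two foundations carry this. Pseudo-difference operators form a ring, which reduces to `Δ ∘ (bc) = (Δ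
∘ b)c` and the injectivity of `Δ ∘`. Formal shifts are ring homomorphisms with `T₊T₋ = 1`, because
they solve the differential equation of an exponential of commuting derivations. -/

/-- The coefficients of `Δᵏ ∘ b`. -/
def deltaMul (k : ℤ) (b : ℤ → ℤ → A) (m n : ℤ) : A :=
  ∑ᶠ l : ℕ, Ring.choose k l • ((fwdDiff (1 : ℤ))^[l] (b (m - k + l)) (n + k - l))

theorem deltaMul_eq_sum {b : ℤ → ℤ → A} {B : ℤ} (hb : ∀ k, B < k → b k = 0) (k m n : ℤ) {N : ℕ}
    (hN : B - m + k < N) :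
    deltaMul k b m n = ∑ l ∈ Finset.range N,
      Ring.choose k l • ((fwdDiff (1 : ℤ))^[l] (b (m - k + l)) (n + k - l)) := by
  refine finsum_eq_sum_of_support_subset _ fun l hl => ?_
  by_contra hlN
  have hlN : N ≤ l := by simpa using hlN
  refine hl ?_
  simp only
  rw [hb (m - k + l) (by omega), fwdDiff_iterate_zero]
  simp

theorem deltaMul_eq_zero {b : ℤ → ℤ → A} {B : ℤ} (hb : ∀ k, B < k → b k = 0) {k m : ℤ}
    (h : B + k < m) (n : ℤ) : deltaMul k b m n = 0 := by
  rw [deltaMul_eq_sum hb k m n (N := 0) (by push_cast; omega)]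
  simp

/-- Above `K₂` the coefficient of `a` vanishes; below `m - B` every index `m - k + l` exceeds `B`.
The bounds need not be sharp, so several products can be expanded over one range. -/
theorem mulCoeff_eq_sum (a b : PsDiff A) {K₁ K₂ B m : ℤ} (ha : ∀ k, K₂ < k → a.coeff k = 0)
    (hb : ∀ k, B < k → b.coeff k = 0) (hm : K₁ ≤ m - B) (n : ℤ) :
    (a * b).coeff m n = ∑ k ∈ Finset.Icc K₁ K₂, a.coeff k n * deltaMul k b.coeff m n := by
  change mulCoeff a b m n = _
  unfold mulCoeff
  rw [finsum_eq_sum_of_support_subset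
    (s := Finset.Icc K₁ K₂ ×ˢ Finset.range (B - m + K₂ + 1).toNat)]
  · rw [Finset.sum_product]
    refine Finset.sum_congr rfl fun k hk => ?_
    rw [Finset.mem_Icc] at hk
    rw [deltaMul_eq_sum hb k m n (N := (B - m + K₂ + 1).toNat) (by omega), Finset.mul_sum]
    refine Finset.sum_congr rfl fun l _ => ?_
    simp only [mul_smul_comm]
  · rintro ⟨k, l⟩ hkl
    by_contra hmem
    refine hkl ?_
    simp only
    by_cases hk : K₂ < k
    · simp [ha k hk]
    · have : B < m - k + l := by
        simp only [Finset.coe_product, Finset.coe_Icc, Finset.coe_range, Set.mem_prod, Set.mem_Icc,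
          Set.mem_Iio, not_and_or, not_le, not_lt] at hmem
        omega
      rw [hb _ this, fwdDiff_iterate_zero]
      simp

/-- Left multiplication by `Δ` on coefficients. -/
def deltaStep (b : ℤ → ℤ → A) (m n : ℤ) : A := b (m - 1) (n + 1) + (b m (n + 1) - b m n)

/-- Pascal's rule: once the terms `l = 0` are split off, the term `l + 1` of `Δᵏ ∘ b` at `m - 1` and
the difference of its terms `l` at `m` involve the same iterated difference of the same coefficient.
-/
theorem deltaStep_deltaMul {b : ℤ → ℤ → A} {B : ℤ} (hb : ∀ k, B < k → b k = 0) (k m n : ℤ) :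
    deltaStep (deltaMul k b) m n = deltaMul (k + 1) b m n := by
  obtain ⟨N, hN⟩ : ∃ N : ℕ, B - m + k + 1 < N := ⟨(B - m + k + 2).toNat, by omega⟩
  unfold deltaStep
  rw [deltaMul_eq_sum hb k (m - 1) (n + 1) (N := N + 1) (by push_cast; omega),
    deltaMul_eq_sum hb k m (n + 1) (N := N) (by omega),
    deltaMul_eq_sum hb k m n (N := N) (by omega),
    deltaMul_eq_sum hb (k + 1) m n (N := N + 1) (by push_cast; omega),
    Finset.sum_range_succ', Finset.sum_range_succ' (n := N), ← Finset.sum_sub_distrib]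
  rw [add_right_comm, ← Finset.sum_add_distrib]
  congr 1
  · refine Finset.sum_congr rfl fun l _ => ?_
    rw [Ring.choose_succ_succ, add_smul, add_comm, ← smul_sub]
    have e1 : m - 1 - k + ((l + 1 : ℕ) : ℤ) = m - (k + 1) + ((l + 1 : ℕ) : ℤ) := by ring
    have e2 : n + 1 + k - ((l + 1 : ℕ) : ℤ) = n + (k + 1) - ((l + 1 : ℕ) : ℤ) := by ring
    rw [e1, e2]
    congr 2
    rw [Function.iterate_succ_apply' (f := fwdDiff (1 : ℤ))]
    have e3 : m - (k + 1) + ((l + 1 : ℕ) : ℤ) = m - k + l := by push_cast; ring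
    rw [e3, fwdDiff]
    congr 2 <;> push_cast <;> ring_nf
  · simp only [Ring.choose_zero_right, one_smul, Function.iterate_zero, id]
    congr 1 <;> push_cast <;> ring_nf

theorem deltaMul_zero_left (b : ℤ → ℤ → A) : deltaMul 0 b = b := by
  funext m n
  unfold deltaMul
  rw [finsum_eq_single _ 0]
  · simp
  · intro l hl
    obtain ⟨l, rfl⟩ := Nat.exists_eq_succ_of_ne_zero hl
    rw [Ring.choose_zero_succ]
    simp

/-- Coefficients are recovered from the top downwards: those of `Δ ∘ b` at `m + 1` determine `b m`
once `b (m + 1)` is known. -/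
theorem deltaStep_injective {b c : ℤ → ℤ → A} {B : ℤ} (hb : ∀ k, B < k → b k = 0)
    (hc : ∀ k, B < k → c k = 0) (h : ∀ m n, deltaStep b m n = deltaStep c m n) : b = c := by
  have key : ∀ d : ℕ, ∀ m, B - d < m → b m = c m := by
    intro d
    induction d with
    | zero =>
      intro m hm
      rw [hb m (by simpa using hm), hc m (by simpa using hm)]
    | succ d ih =>
      intro m hm
      funext n
      have h1 := h (m + 1) (n - 1)
      unfold deltaStep at h1
      rw [ih (m + 1) (by push_cast at hm; omega)] at h1
      simpa using h1
  funext m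
  exact key (B - m + 1).toNat m (by omega)

/-- The operator `Δᵏ ∘ b`. -/
def delta (k : ℤ) (b : PsDiff A) : PsDiff A where
  coeff := deltaMul k b.coeff
  bounded := by
    obtain ⟨B, hb⟩ := b.bounded
    exact ⟨B + k, fun m hm => funext fun n => deltaMul_eq_zero hb hm n⟩

/-- Term by term, `Δ ∘ (bₖ Δᵏ c) = bₖ(n+1) Δᵏ⁺¹ c + (Δbₖ) Δᵏ c`; reindexing the first kind of term
collects the coefficients of `Δ ∘ b`. -/
theorem deltaStep_mul (b c : PsDiff A) (m n : ℤ) :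
    deltaStep (b * c).coeff m n = (delta 1 b * c).coeff m n := by
  obtain ⟨B, hb⟩ := b.bounded
  obtain ⟨C, hc⟩ := c.bounded
  have hd : ∀ m n, (delta 1 b).coeff m n = deltaStep b.coeff m n := fun m n => by
    have := deltaStep_deltaMul hb 0 m n
    rw [deltaMul_zero_left, zero_add] at this
    exact this.symm
  have hd' : ∀ k, B + 1 < k → (delta 1 b).coeff k = 0 := fun k hk => by
    funext n
    rw [hd, deltaStep, hb _ (by omega), hb _ (by omega)]
    simp
  unfold deltaStep
  -- Low enough to serve as lower summation bound at both `m - 1` and `m`, with room for the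
  -- reindexing `k ↦ k + 1`.
  set K := m - C - 2
  rw [mulCoeff_eq_sum b c hb hc (K₁ := K) (by omega), mulCoeff_eq_sum b c hb hc (K₁ := K) (by omega),
    mulCoeff_eq_sum b c hb hc (K₁ := K) (by omega),
    mulCoeff_eq_sum _ c hd' hc (K₁ := K + 1) (by omega)]
  have hR : ∀ k, (delta 1 b).coeff k n * deltaMul k c.coeff m n =
      b.coeff (k - 1) (n + 1) * deltaMul k c.coeff m n +
      (b.coeff k (n + 1) - b.coeff k n) * deltaMul k c.coeff m n := fun k => by
    rw [hd, deltaStep]; ring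
  simp only [hR, Finset.sum_add_distrib]
  have s1 : ∑ k ∈ Finset.Icc (K + 1) (B + 1), b.coeff (k - 1) (n + 1) * deltaMul k c.coeff m n =
      ∑ k ∈ Finset.Icc K B, b.coeff k (n + 1) * deltaMul (k + 1) c.coeff m n := by
    refine (Finset.sum_nbij' (fun k => k + 1) (fun k => k - 1) ?_ ?_ ?_ ?_ ?_).symm
    · intro k hk; simp only [Finset.mem_Icc] at *; omega
    · intro k hk; simp only [Finset.mem_Icc] at *; omega
    · intro k hk; simp
    · intro k hk; simp
    · intro k hk; simp
  have s2 : ∑ k ∈ Finset.Icc (K + 1) (B + 1),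
        (b.coeff k (n + 1) - b.coeff k n) * deltaMul k c.coeff m n =
      ∑ k ∈ Finset.Icc K B, (b.coeff k (n + 1) - b.coeff k n) * deltaMul k c.coeff m n := by
    have hs : Finset.Icc (K + 1) B ⊆ Finset.Icc (K + 1) (B + 1) :=
      Finset.Icc_subset_Icc le_rfl (by omega)
    have hs' : Finset.Icc (K + 1) B ⊆ Finset.Icc K B :=
      Finset.Icc_subset_Icc (by omega) le_rfl
    rw [← Finset.sum_subset hs, ← Finset.sum_subset hs']
    · intro k hk hk'
      simp only [Finset.mem_Icc] at hk hk'
      rw [deltaMul_eq_zero hc (by omega), mul_zero]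
    · intro k hk hk'
      simp only [Finset.mem_Icc] at hk hk'
      rw [hb k (by omega)]
      simp
  rw [s1, s2, ← Finset.sum_sub_distrib, ← Finset.sum_add_distrib, ← Finset.sum_add_distrib]
  refine Finset.sum_congr rfl fun k _ => ?_
  rw [← deltaStep_deltaMul hc k m n, deltaStep]
  ring

theorem delta_add_one (k : ℤ) (b : PsDiff A) (m n : ℤ) :
    deltaStep (delta k b).coeff m n = (delta (k + 1) b).coeff m n := by
  obtain ⟨B, hb⟩ := b.bounded
  exact deltaStep_deltaMul hb k m n

theorem delta_one_delta (k : ℤ) (b : PsDiff A) : delta 1 (delta k b) = delta (k + 1) b := by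
  ext m n
  rw [← delta_add_one, ← zero_add (1 : ℤ), ← delta_add_one]
  change deltaStep (deltaMul 0 _) m n = _
  rw [deltaMul_zero_left]

theorem delta_injective_one {b c : PsDiff A}
    (h : ∀ m n, deltaStep b.coeff m n = deltaStep c.coeff m n) : b = c := by
  obtain ⟨B, hb⟩ := b.bounded
  obtain ⟨C, hc⟩ := c.bounded
  refine PsDiff.ext (deltaStep_injective (B := max B C) (fun k hk => hb k ?_) (fun k hk => hc k ?_) h)
  · exact lt_of_le_of_lt (le_max_left _ _) hk
  · exact lt_of_le_of_lt (le_max_right _ _) hk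

/-- Induction in both directions from `k = 0`: upwards by associativity with one `Δ`, downwards by
cancelling a `Δ` on the left. -/
theorem delta_mul (k : ℤ) (b c : PsDiff A) : delta k (b * c) = delta k b * c := by
  have h0 : ∀ b : PsDiff A, delta 0 b = b := fun b => PsDiff.ext (deltaMul_zero_left b.coeff)
  induction k using Int.induction_on with
  | zero => rw [h0, h0]
  | succ k ih =>
    ext m n
    rw [← delta_add_one, ih, deltaStep_mul, delta_one_delta]
  | pred k ih =>
    refine delta_injective_one fun m n => ?_
    rw [delta_add_one, deltaStep_mul, delta_one_delta, sub_add_cancel, ih]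

/-- Expanding `a` into terms `aₖ Δᵏ` leaves the case `a = Δᵏ`, which is `delta_mul`. -/
protected theorem mul_assoc (a b c : PsDiff A) : a * b * c = a * (b * c) := by
  obtain ⟨K, ha⟩ := a.bounded
  obtain ⟨B, hb⟩ := b.bounded
  obtain ⟨C, hc⟩ := c.bounded
  have hab : ∀ k, K + B < k → (a * b).coeff k = 0 := fun k hk => funext fun n => by
    rw [mulCoeff_eq_sum a b ha hb (K₁ := K + 1) (by omega)]
    simp
  have hbc : ∀ k, B + C < k → (b * c).coeff k = 0 := fun k hk => funext fun n => by
    rw [mulCoeff_eq_sum b c hb hc (K₁ := B + 1) (by omega)]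
    simp
  ext m n
  rw [mulCoeff_eq_sum _ c hab hc (K₁ := m - C) le_rfl,
    mulCoeff_eq_sum a _ ha hbc (K₁ := m - C - B) (by omega)]
  have hL : ∀ j ∈ Finset.Icc (m - C) (K + B), (a * b).coeff j n * deltaMul j c.coeff m n =
      ∑ k ∈ Finset.Icc (m - C - B) K,
        a.coeff k n * (deltaMul k b.coeff j n * deltaMul j c.coeff m n) := fun j hj => by
    rw [Finset.mem_Icc] at hj
    rw [mulCoeff_eq_sum a b ha hb (K₁ := m - C - B) (by omega), Finset.sum_mul]
    exact Finset.sum_congr rfl fun k _ => by ring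
  rw [Finset.sum_congr rfl hL, Finset.sum_comm]
  refine Finset.sum_congr rfl fun k hk => ?_
  rw [Finset.mem_Icc] at hk
  rw [← Finset.mul_sum]
  congr 1
  have hd : ∀ j, K + B < j → (delta k b).coeff j = 0 := fun j hj => funext fun n =>
    deltaMul_eq_zero hb (by omega) n
  exact (mulCoeff_eq_sum (delta k b) c hd hc le_rfl n).symm.trans (by rw [← delta_mul]; rfl)

end PsDiff
end DmKP

/-! ### The ring of pseudo-difference operators, positive parts, and maps of coefficients. -/

namespace DmKP
namespace PsDiff

variable {A : Type*} [CommRing A]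

instance : Zero (PsDiff A) := ⟨⟨0, 0, fun _ _ => rfl⟩⟩

instance : Add (PsDiff A) where
  add a b :=
    { coeff := a.coeff + b.coeff
      bounded := by
        obtain ⟨K, ha⟩ := a.bounded
        obtain ⟨B, hb⟩ := b.bounded
        refine ⟨max K B, fun m hm => ?_⟩
        rw [max_lt_iff] at hm
        simp [ha m hm.1, hb m hm.2] }

instance : Neg (PsDiff A) where
  neg a :=
    { coeff := -a.coeff
      bounded := by
        obtain ⟨K, ha⟩ := a.bounded
        exact ⟨K, fun m hm => by simp [ha m hm]⟩ }

theorem coeff_add (a b : PsDiff A) : (a + b).coeff = a.coeff + b.coeff := rfl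
theorem coeff_neg (a : PsDiff A) : (-a).coeff = -a.coeff := rfl
theorem coeff_one : (1 : PsDiff A).coeff = fun k => if k = 0 then 1 else 0 := rfl
theorem coeff_deltaPow (j k : ℤ) :
    (deltaPow j : PsDiff A).coeff k = if k = j then 1 else 0 := rfl

instance : AddGroup (PsDiff A) :=
  AddGroup.ofLeftAxioms (fun _ _ _ => PsDiff.ext (add_assoc _ _ _))
    (fun _ => PsDiff.ext (zero_add _)) (fun _ => PsDiff.ext (neg_add_cancel _))

instance : AddCommGroup (PsDiff A) :=
  { (inferInstance : AddGroup (PsDiff A)) with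
    add_comm := fun _ _ => PsDiff.ext (add_comm _ _) }

/-- The coefficients, as an additive map. -/
def coeffHom : PsDiff A →+ (ℤ → ℤ → A) where
  toFun := coeff
  map_zero' := rfl
  map_add' _ _ := rfl

theorem coeff_sub (a b : PsDiff A) : (a - b).coeff = a.coeff - b.coeff := coeffHom.map_sub a b

theorem coeff_nsmul (k : ℕ) (a : PsDiff A) : (k • a).coeff = k • a.coeff := map_nsmul coeffHom k a

theorem coeff_sum {ι : Type*} (s : Finset ι) (f : ι → PsDiff A) (m n : ℤ) :
    (∑ i ∈ s, f i).coeff m n = ∑ i ∈ s, (f i).coeff m n := by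
  have := map_sum coeffHom f s
  change (∑ i ∈ s, f i).coeff = ∑ i ∈ s, (f i).coeff at this
  rw [this]
  simp

theorem exists_common_bound (a b : PsDiff A) :
    ∃ K : ℤ, (∀ k, K < k → a.coeff k = 0) ∧ ∀ k, K < k → b.coeff k = 0 := by
  obtain ⟨K, ha⟩ := a.bounded
  obtain ⟨B, hb⟩ := b.bounded
  exact ⟨max K B, fun k hk => ha k ((le_max_left _ _).trans_lt hk),
    fun k hk => hb k ((le_max_right _ _).trans_lt hk)⟩

theorem deltaMul_add {b c : ℤ → ℤ → A} {B : ℤ} (hb : ∀ k, B < k → b k = 0)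
    (hc : ∀ k, B < k → c k = 0) (k m n : ℤ) :
    deltaMul k (b + c) m n = deltaMul k b m n + deltaMul k c m n := by
  obtain ⟨N, hN⟩ : ∃ N : ℕ, B - m + k < N := ⟨(B - m + k + 1).toNat, by omega⟩
  rw [deltaMul_eq_sum hb k m n hN, deltaMul_eq_sum hc k m n hN,
    deltaMul_eq_sum (B := B) (fun j hj => by simp [hb j hj, hc j hj]) k m n hN,
    ← Finset.sum_add_distrib]
  refine Finset.sum_congr rfl fun l _ => ?_
  rw [Pi.add_apply, fwdDiff_iter_add, Pi.add_apply, smul_add]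

protected theorem mul_add (a b c : PsDiff A) : a * (b + c) = a * b + a * c := by
  obtain ⟨K, ha⟩ := a.bounded
  obtain ⟨B, hb, hc⟩ := exists_common_bound b c
  ext m n
  rw [coeff_add, Pi.add_apply, Pi.add_apply, mulCoeff_eq_sum a b ha hb le_rfl,
    mulCoeff_eq_sum a c ha hc le_rfl, mulCoeff_eq_sum a (b + c) ha (B := B)
      (fun k hk => by simp [coeff_add, hb k hk, hc k hk]) le_rfl, ← Finset.sum_add_distrib]
  refine Finset.sum_congr rfl fun k _ => ?_
  rw [coeff_add, deltaMul_add hb hc, mul_add]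

protected theorem add_mul (a b c : PsDiff A) : (a + b) * c = a * c + b * c := by
  obtain ⟨K, ha, hb⟩ := exists_common_bound a b
  obtain ⟨C, hc⟩ := c.bounded
  ext m n
  rw [coeff_add, Pi.add_apply, Pi.add_apply, mulCoeff_eq_sum a c ha hc le_rfl,
    mulCoeff_eq_sum b c hb hc le_rfl, mulCoeff_eq_sum (a + b) c (K₂ := K)
      (fun k hk => by simp [coeff_add, ha k hk, hb k hk]) hc le_rfl, ← Finset.sum_add_distrib]
  refine Finset.sum_congr rfl fun k _ => ?_
  rw [coeff_add, Pi.add_apply, Pi.add_apply, add_mul]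

theorem mul_coeff_of_single {a : PsDiff A} {j : ℤ} (ha : ∀ k, k ≠ j → a.coeff k = 0)
    (b : PsDiff A) (m n : ℤ) : (a * b).coeff m n = a.coeff j n * deltaMul j b.coeff m n := by
  obtain ⟨B, hb⟩ := b.bounded
  rw [mulCoeff_eq_sum a b (K₁ := min j (m - B)) (K₂ := j) (fun k hk => ha k hk.ne') hb
    (min_le_right _ _), Finset.sum_eq_single j]
  · intro k _ hk
    simp [ha k hk]
  · simp

theorem deltaMul_single (j k : ℤ) (c : A) (m n : ℤ) :
    deltaMul k (fun i => if i = j then fun _ => c else 0) m n = if m = k + j then c else 0 := by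
  unfold deltaMul
  rw [finsum_eq_single _ 0]
  · by_cases h : m = k + j
    · simp [h]
    · have h' : ¬ m - k = j := fun h' => h (by omega)
      simp [h, h']
  · intro l hl
    obtain ⟨l, rfl⟩ := Nat.exists_eq_succ_of_ne_zero hl
    have h : (fwdDiff (1 : ℤ)) (if m - k + ((l + 1 : ℕ) : ℤ) = j then fun _ => c else 0) = 0 := by
      funext x
      split_ifs <;> simp [fwdDiff]
    rw [Nat.succ_eq_add_one, Function.iterate_succ_apply, h, fwdDiff_iterate_zero]
    simp

theorem mul_deltaPow_coeff (a : PsDiff A) (j m n : ℤ) :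
    (a * deltaPow j).coeff m n = a.coeff (m - j) n := by
  obtain ⟨K, ha⟩ := a.bounded
  have hc : (deltaPow j : PsDiff A).coeff = 
      fun i => if i = j then fun _ : ℤ => (1 : A) else (0 : ℤ → A) := rfl
  rw [mulCoeff_eq_sum a (deltaPow j) (K₁ := m - j) (K₂ := max K (m - j)) (B := j)
    (fun k hk => ha k ((le_max_left _ _).trans_lt hk)) (fun k hk => if_neg hk.ne') le_rfl,
    Finset.sum_eq_single (m - j), hc, deltaMul_single]
  · simp
  · intro k _ hk
    rw [hc, deltaMul_single, if_neg (fun h => hk (by omega)), mul_zero]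
  · simp

instance : Ring (PsDiff A) :=
  { (inferInstance : AddCommGroup (PsDiff A)) with
    left_distrib := PsDiff.mul_add
    right_distrib := PsDiff.add_mul
    zero_mul := fun a => by
      have := PsDiff.add_mul 0 0 a
      rwa [add_zero, left_eq_add] at this
    mul_zero := fun a => by
      have := PsDiff.mul_add a 0 0
      rwa [add_zero, left_eq_add] at this
    mul_assoc := PsDiff.mul_assoc
    one_mul := fun a => by
      ext m n
      rw [mul_coeff_of_single (j := 0) (fun k hk => if_neg hk), deltaMul_zero_left, coeff_one]
      simp
    mul_one := fun a => by
      ext m n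
      exact (mul_deltaPow_coeff a 0 m n).trans (by rw [sub_zero]) }

theorem deltaPow_add (i j : ℤ) : (deltaPow i * deltaPow j : PsDiff A) = deltaPow (i + j) := by
  ext m n
  rw [mul_deltaPow_coeff, coeff_deltaPow, coeff_deltaPow]
  simp only [sub_eq_iff_eq_add]

theorem deltaMul_one (b : PsDiff A) : deltaMul 1 b.coeff = deltaStep b.coeff := by
  obtain ⟨B, hb⟩ := b.bounded
  funext m n
  rw [← zero_add (1 : ℤ), ← deltaStep_deltaMul hb, deltaMul_zero_left]

/-- The operator of multiplication by a function. -/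
def ofFun (f : ℤ → A) : PsDiff A where
  coeff k := if k = 0 then f else 0
  bounded := ⟨0, fun _ hk => if_neg hk.ne'⟩

theorem ofFun_mul_coeff (f : ℤ → A) (b : PsDiff A) (m n : ℤ) :
    (ofFun f * b).coeff m n = f n * b.coeff m n := by
  rw [mul_coeff_of_single (j := 0) (fun k hk => if_neg hk), deltaMul_zero_left]
  rfl

/-- Only the coefficients of `Δ, Δ², …` may be nonzero. -/
def IsPos (a : PsDiff A) : Prop := ∀ k ≤ 0, a.coeff k = 0

theorem isPos_zero : IsPos (0 : PsDiff A) := fun _ _ => rfl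

theorem IsPos.add {a b : PsDiff A} (ha : IsPos a) (hb : IsPos b) : IsPos (a + b) := fun k hk => by
  rw [coeff_add, Pi.add_apply, ha k hk, hb k hk, add_zero]

theorem IsPos.sum {ι : Type*} {s : Finset ι} {f : ι → PsDiff A} (h : ∀ i ∈ s, IsPos (f i)) :
    IsPos (∑ i ∈ s, f i) := fun k hk => by
  funext n
  rw [coeff_sum, Finset.sum_eq_zero]
  · rfl
  · intro i hi
    rw [h i hi k hk]
    rfl

theorem deltaMul_eq_zero_of_isPos {b : PsDiff A} (hb : IsPos b) (k : ℕ) {m : ℤ} (hm : m ≤ 0)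
    (n : ℤ) : deltaMul k b.coeff m n = 0 := by
  obtain ⟨B, hB⟩ := b.bounded
  induction k generalizing m n with
  | zero => rw [Nat.cast_zero, deltaMul_zero_left, hb m hm]; rfl
  | succ k ih =>
    rw [Nat.cast_succ, ← deltaStep_deltaMul hB, deltaStep, ih (by omega), ih hm, ih hm]
    simp

theorem isPos_mul {a b : PsDiff A} (ha : ∀ k < 0, a.coeff k = 0) (hb : IsPos b) :
    IsPos (a * b) := fun m hm => by
  obtain ⟨K, hK⟩ := a.bounded
  obtain ⟨B, hB⟩ := b.bounded
  funext n
  rw [mulCoeff_eq_sum a b hK hB le_rfl, Finset.sum_eq_zero]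
  · rfl
  intro k _
  rcases lt_or_ge k 0 with h | h
  · simp [ha k h]
  · lift k to ℕ using h
    rw [deltaMul_eq_zero_of_isPos hb k hm, mul_zero]

theorem mul_coeff_top {a b : PsDiff A} {K B : ℤ} (ha : ∀ k, K < k → a.coeff k = 0)
    (hb : ∀ k, B < k → b.coeff k = 0) (n : ℤ) :
    (a * b).coeff (K + B) n = a.coeff K n * b.coeff B (n + K) := by
  rw [mulCoeff_eq_sum a b ha hb (K₁ := K) (by omega), Finset.Icc_self, Finset.sum_singleton,
    deltaMul_eq_sum hb K (K + B) n (N := 1) (by push_cast; omega)]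
  simp

/-- An invertible leading coefficient of order zero preserves the order under right multiplication:
the top coefficient of `a * b` is that of `a` times a unit. Applied downwards from any bound for
`a`. -/
theorem coeff_eq_zero_of_mul {a b : PsDiff A} {M : ℤ} (hb : ∀ k, 0 < k → b.coeff k = 0)
    (hb0 : ∀ n, IsUnit (b.coeff 0 n)) (hab : ∀ m, M < m → (a * b).coeff m = 0) :
    ∀ m, M < m → a.coeff m = 0 := by
  obtain ⟨K, ha⟩ := a.bounded
  have key : ∀ d : ℕ, ∀ m, M < m → K - d < m → a.coeff m = 0 := by
    intro d
    induction d with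
    | zero => exact fun m _ hm => ha m (by simpa using hm)
    | succ d ih =>
      intro m hM hm
      funext n
      rcases eq_or_lt_of_le (show K - d ≤ m by push_cast at hm; omega) with h | h
      · have := mul_coeff_top (a := a) (K := m) (fun k hk => ih k (by omega) (by omega)) hb n
        rw [add_zero, hab m hM] at this
        exact ((hb0 _).mul_left_eq_zero).1 this.symm
      · rw [ih m hM h]
  exact fun m hm => key (K - m + 1).toNat m hm (by omega)

/-- Application of an additive map to all coefficients. -/
def mapCoeff {B : Type*} [CommRing B] (f : A →+ B) (a : PsDiff A) : PsDiff B where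
  coeff k n := f (a.coeff k n)
  bounded := by
    obtain ⟨K, ha⟩ := a.bounded
    exact ⟨K, fun k hk => funext fun n => by simp [ha k hk]⟩

theorem fwdDiff_iterate_map {B : Type*} [CommRing B] (f : A →+ B) (l : ℕ) (g : ℤ → A) (n : ℤ) :
    (fwdDiff (1 : ℤ))^[l] (fun n => f (g n)) n = f ((fwdDiff (1 : ℤ))^[l] g n) := by
  induction l generalizing n with
  | zero => rfl
  | succ l ih => simp only [Function.iterate_succ_apply', fwdDiff, ih, map_sub]

theorem deltaMul_map {B : Type*} [CommRing B] (f : A →+ B) (b : PsDiff A) (k m n : ℤ) :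
    deltaMul k (mapCoeff f b).coeff m n = f (deltaMul k b.coeff m n) := by
  obtain ⟨C, hb⟩ := b.bounded
  obtain ⟨N, hN⟩ : ∃ N : ℕ, C - m + k < N := ⟨(C - m + k + 1).toNat, by omega⟩
  rw [deltaMul_eq_sum hb k m n hN, deltaMul_eq_sum (B := C)
    (fun k hk => funext fun n => by simp [mapCoeff, hb k hk]) k m n hN, map_sum]
  refine Finset.sum_congr rfl fun l _ => ?_
  rw [map_zsmul, ← fwdDiff_iterate_map]
  rfl

theorem mapCoeff_mul {B : Type*} [CommRing B] (f : A →+* B) (a b : PsDiff A) :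
    mapCoeff (f : A →+ B) (a * b) = mapCoeff (f : A →+ B) a * mapCoeff (f : A →+ B) b := by
  obtain ⟨K, ha⟩ := a.bounded
  obtain ⟨C, hb⟩ := b.bounded
  ext m n
  rw [mulCoeff_eq_sum _ _ (K₂ := K) (B := C)
    (fun k hk => funext fun n => by simp [mapCoeff, ha k hk])
    (fun k hk => funext fun n => by simp [mapCoeff, hb k hk]) le_rfl]
  simp only [deltaMul_map]
  change f ((a * b).coeff m n) = _
  rw [mulCoeff_eq_sum a b ha hb le_rfl, map_sum]
  exact Finset.sum_congr rfl fun k _ => map_mul f _ _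

theorem mapCoeff_deltaPow {B : Type*} [CommRing B] (f : A →+* B) (j : ℤ) :
    mapCoeff (f : A →+ B) (deltaPow j) = deltaPow j := by
  ext m n
  change f ((deltaPow j : PsDiff A).coeff m n) = _
  rw [coeff_deltaPow, coeff_deltaPow]
  split_ifs <;> simp

theorem mapCoeff_npowRec {B : Type*} [CommRing B] (f : A →+* B) (a : PsDiff A) (k : ℕ) :
    mapCoeff (f : A →+ B) (npowRec k a) = npowRec k (mapCoeff (f : A →+ B) a) := by
  induction k with
  | zero => exact mapCoeff_deltaPow f 0
  | succ k ih => rw [npowRec, npowRec, mapCoeff_mul, ih]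

theorem mapCoeff_nonpos {B : Type*} [CommRing B] (f : A →+* B) (a : PsDiff A) :
    mapCoeff (f : A →+ B) a.nonpos = (mapCoeff (f : A →+ B) a).nonpos := by
  ext m n
  change f ((if m ≤ 0 then a.coeff m else 0) n) = (if m ≤ 0 then fun n => f (a.coeff m n) else 0) n
  split_ifs <;> simp

/-- A derivation of the ring of coefficients is a derivation of the operators. -/
theorem mapCoeff_derivation_mul {𝕜 : Type*} [CommRing 𝕜] [Algebra 𝕜 A] (d : Derivation 𝕜 A A)
    (a b : PsDiff A) : mapCoeff (d : A →+ A) (a * b) =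
      mapCoeff (d : A →+ A) a * b + a * mapCoeff (d : A →+ A) b := by
  obtain ⟨K, ha⟩ := a.bounded
  obtain ⟨C, hb⟩ := b.bounded
  ext m n
  rw [coeff_add, Pi.add_apply, Pi.add_apply, mulCoeff_eq_sum (mapCoeff _ a) _ (K₂ := K)
    (fun k hk => funext fun n => by simp [mapCoeff, ha k hk]) hb le_rfl,
    mulCoeff_eq_sum a (mapCoeff _ b) (B := C) ha
    (fun k hk => funext fun n => by simp [mapCoeff, hb k hk]) le_rfl]
  simp only [deltaMul_map]
  change d ((a * b).coeff m n) = _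
  rw [mulCoeff_eq_sum a b ha hb le_rfl, map_sum, ← Finset.sum_add_distrib]
  refine Finset.sum_congr rfl fun k _ => ?_
  rw [d.leibniz, smul_eq_mul, smul_eq_mul, add_comm, mul_comm (deltaMul k b.coeff m n)]
  rfl

/-- The coefficients of a right inverse of an operator of order zero lie in every subring which
contains the coefficients of the operator and the inverse of the leading one. -/
theorem coeff_mem_of_mul_eq_one {R : Subring A} {a b : PsDiff A} (ha : ∀ k, 0 < k → a.coeff k = 0)
    (haR : ∀ k n, a.coeff k n ∈ R) (hinv : ∀ n, ∃ u ∈ R, u * a.coeff 0 n = 1) (hab : a * b = 1)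
    (m n : ℤ) : b.coeff m n ∈ R := by
  obtain ⟨B, hb⟩ := b.bounded
  have key : ∀ d : ℕ, ∀ m, B - d < m → ∀ n, b.coeff m n ∈ R := by
    intro d
    induction d with
    | zero =>
      intro m hm n
      rw [hb m (by simpa using hm)]
      exact R.zero_mem
    | succ d ih =>
      intro m hm n
      obtain ⟨u, hu, hu1⟩ := hinv n
      have hm0 : (a * b).coeff m n ∈ R := by
        rw [hab]
        change (if m = 0 then (1 : ℤ → A) else 0) n ∈ R
        split_ifs
        exacts [R.one_mem, R.zero_mem]
      rw [mulCoeff_eq_sum a b ha hb (K₁ := min 0 (m - B)) (min_le_right _ _)] at hm0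
      have hmem : (0 : ℤ) ∈ Finset.Icc (min 0 (m - B)) 0 := by simp
      -- The term `k = 0` is `a₀ bₘ`; all other `k` are negative and involve only coefficients of
      -- `b` of index above `m`, which lie in `R` by induction.
      rw [← Finset.add_sum_erase _ _ hmem, deltaMul_zero_left] at hm0
      have hrest : ∑ k ∈ (Finset.Icc (min 0 (m - B)) 0).erase 0,
          a.coeff k n * deltaMul k b.coeff m n ∈ R := by
        refine R.sum_mem fun k hk => R.mul_mem (haR k n) ?_
        simp only [Finset.mem_erase, Finset.mem_Icc] at hk
        obtain ⟨N, hN⟩ : ∃ N : ℕ, B - m + k < N := ⟨(B - m + k + 1).toNat, by omega⟩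
        rw [deltaMul_eq_sum hb k m n hN]
        refine R.sum_mem fun l _ => R.zsmul_mem ?_ _
        have hg : ∀ x, b.coeff (m - k + l) x ∈ R := ih _ (by push_cast at hm; omega)
        have : ∀ (l : ℕ) (g : ℤ → A) (_ : ∀ x, g x ∈ R) (x : ℤ),
            (fwdDiff (1 : ℤ))^[l] g x ∈ R := by
          intro l
          induction l with
          | zero => exact fun g hg x => hg x
          | succ l ih' =>
            intro g hg x
            rw [Function.iterate_succ_apply']
            exact R.sub_mem (ih' g hg _) (ih' g hg _)
        exact this l _ hg _
      have h1 := (R.add_mem_cancel_right hrest).1 hm0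
      have h2 := R.mul_mem hu h1
      rwa [← mul_assoc, hu1, one_mul] at h2
  exact key (B - m + 1).toNat m (by omega) n

end PsDiff
end DmKP

/-! ### Formal shifts as exponentials of commuting derivations. -/

namespace DmKP

open PowerSeries Finset

theorem sum_antidiagonal_assoc {M : Type*} [AddCommMonoid M] (f : ℕ → ℕ → ℕ → M) (k : ℕ) :
    ∑ p ∈ antidiagonal k, ∑ q ∈ antidiagonal p.2, f p.1 q.1 q.2 =
      ∑ p ∈ antidiagonal k, ∑ q ∈ antidiagonal p.1, f q.1 q.2 p.2 := by
  rw [sum_sigma', sum_sigma']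
  refine sum_nbij' (fun x => ⟨(x.1.1 + x.2.1, x.2.2), (x.1.1, x.2.1)⟩)
    (fun x => ⟨(x.2.1, x.2.2 + x.1.2), (x.2.2, x.1.2)⟩) ?_ ?_ ?_ ?_ ?_
  all_goals
    rintro ⟨⟨a, b⟩, ⟨c, d⟩⟩ h
    simp only [mem_sigma, HasAntidiagonal.mem_antidiagonal, and_true] at h ⊢
  · omega
  · omega
  · obtain ⟨-, rfl⟩ := h; rfl
  · obtain ⟨-, rfl⟩ := h; rfl

theorem sum_antidiagonal_interchange {M : Type*} [AddCommMonoid M] (f : ℕ → ℕ → ℕ → ℕ → M) (k : ℕ) :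
    ∑ x ∈ antidiagonal k, ∑ y ∈ antidiagonal x.1, ∑ z ∈ antidiagonal x.2, f y.1 y.2 z.1 z.2 =
      ∑ x ∈ antidiagonal k, ∑ y ∈ antidiagonal x.1, ∑ z ∈ antidiagonal x.2,
        f y.1 z.1 y.2 z.2 := by
  simp only [sum_sigma']
  refine sum_nbij' (fun x => ⟨(x.2.1.1 + x.2.2.1, x.2.1.2 + x.2.2.2),
      ⟨(x.2.1.1, x.2.2.1), (x.2.1.2, x.2.2.2)⟩⟩) (fun x => ⟨(x.2.1.1 + x.2.2.1, x.2.1.2 + x.2.2.2),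
      ⟨(x.2.1.1, x.2.2.1), (x.2.1.2, x.2.2.2)⟩⟩) ?_ ?_ ?_ ?_ ?_
  all_goals
    rintro ⟨⟨a, b⟩, ⟨c, d⟩, ⟨e, g⟩⟩ h
    simp only [mem_sigma, HasAntidiagonal.mem_antidiagonal, and_true, and_self] at h ⊢
  · omega
  · omega
  · obtain ⟨-, rfl, rfl⟩ := h; rfl
  · obtain ⟨-, rfl, rfl⟩ := h; rfl

/-! ### The Euler operator `s d/ds` -/

section Euler

variable {S : Type*} [Ring S]

/-- The operator `s d/ds` on power series in `s`. -/
def euler (F : S⟦X⟧) : S⟦X⟧ := PowerSeries.mk fun k => k • coeff k F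

theorem coeff_euler (F : S⟦X⟧) (k : ℕ) : coeff k (euler F) = k • coeff k F := by
  rw [euler, coeff_mk]

theorem euler_mul (F G : S⟦X⟧) : euler (F * G) = euler F * G + F * euler G := by
  ext k
  simp only [map_add, coeff_euler, coeff_mul, smul_sum, ← sum_add_distrib]
  refine sum_congr rfl fun p hp => ?_
  rw [← HasAntidiagonal.mem_antidiagonal.1 hp, add_smul, smul_mul_assoc, mul_smul_comm]

theorem euler_C (c : S) : euler (C c) = 0 := by
  ext k
  rw [coeff_euler, coeff_C]
  split_ifs with h
  · simp [h]
  · simp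

/-- In a noncommutative ring the power rule needs `x` to commute with its derivative. -/
theorem euler_pow {x y : S⟦X⟧} (hxy : Commute x y) (hx : euler x = y) (m : ℕ) :
    euler (x ^ (m + 1)) = (m + 1) • (y * x ^ m) := by
  induction m with
  | zero => simp [hx]
  | succ m ih =>
    rw [pow_succ', euler_mul, ih, hx, mul_smul_comm, ← mul_assoc, hxy.eq, mul_assoc, ← pow_succ',
      add_smul (m + 1), one_smul, add_comm]

end Euler

/-! ### The diagonal of a power series in two variables -/

/-- Setting both variables of a series equal to each other. -/
def diag {R : Type*} [CommRing R] : R⟦X⟧⟦X⟧ →+* R⟦X⟧ where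
  toFun F := PowerSeries.mk fun k => ∑ p ∈ antidiagonal k, coeff p.1 (coeff p.2 F)
  map_zero' := by ext k; simp
  map_add' F G := by ext k; simp [sum_add_distrib]
  map_one' := by
    ext k
    rw [coeff_mk, sum_eq_single (k, 0)]
    · simp
    · rintro ⟨a, b⟩ h h'
      have : b ≠ 0 := by
        rintro rfl
        exact h' (by rw [← HasAntidiagonal.mem_antidiagonal.1 h]; simp)
      simp [coeff_one, this]
    · simp
  map_mul' F G := by
    ext k
    simp only [coeff_mk, coeff_mul, map_sum]
    have h : ∀ a b : ℕ, ∑ q ∈ antidiagonal b, ∑ r ∈ antidiagonal a,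
          coeff r.1 (coeff q.1 F) * coeff r.2 (coeff q.2 G) =
        ∑ r ∈ antidiagonal a, ∑ q ∈ antidiagonal b,
          coeff r.1 (coeff q.1 F) * coeff r.2 (coeff q.2 G) := fun a b => sum_comm
    simp only [h, sum_mul_sum]
    exact sum_antidiagonal_interchange
      (fun a b c d => coeff a (coeff c F) * coeff b (coeff d G)) k

theorem coeff_diag {R : Type*} [CommRing R] (F : R⟦X⟧⟦X⟧) (k : ℕ) :
    coeff k (diag F) = ∑ p ∈ antidiagonal k, coeff p.1 (coeff p.2 F) := by
  change coeff k (PowerSeries.mk fun k => ∑ p ∈ antidiagonal k, coeff p.1 (coeff p.2 F)) = _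
  rw [coeff_mk]

theorem diag_C {R : Type*} [CommRing R] (F : R⟦X⟧) : diag (C F) = F := by
  ext k
  rw [coeff_diag, sum_eq_single (k, 0)]
  · simp
  · rintro ⟨a, b⟩ h h'
    have : b ≠ 0 := by
      rintro rfl
      exact h' (by rw [← HasAntidiagonal.mem_antidiagonal.1 h]; simp)
    simp [coeff_C, this]
  · simp

theorem diag_map_C {R : Type*} [CommRing R] (F : R⟦X⟧) : diag (PowerSeries.map C F) = F := by
  ext k
  rw [coeff_diag, sum_eq_single (0, k)]
  · simp
  · rintro ⟨a, b⟩ h h'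
    have : a ≠ 0 := by
      rintro rfl
      exact h' (by rw [← HasAntidiagonal.mem_antidiagonal.1 h]; simp)
    simp [coeff_C, this]
  · simp

theorem diag_X {R : Type*} [CommRing R] : diag (X : R⟦X⟧⟦X⟧) = X := by
  rw [← diag_map_C (X : R⟦X⟧), map_X]

/-! ### Formal shifts -/

section Shift

variable {𝕜 R : Type*} [Field 𝕜] [CommRing R] [Algebra 𝕜 R]

/-- The series `∑ᵢ cᵢ sⁱ⁺¹ ∂ᵢ`. -/
def fieldSeries (D : ℕ → Derivation 𝕜 R R) (c : ℕ → 𝕜) : (Module.End 𝕜 R)⟦X⟧ :=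
  PowerSeries.mk fun | 0 => 0 | i + 1 => c i • (D i : R →ₗ[𝕜] R)

variable (D : ℕ → Derivation 𝕜 R R)

theorem coeff_zero_fieldSeries (c : ℕ → 𝕜) : coeff 0 (fieldSeries D c) = 0 := coeff_mk _ _

theorem coeff_succ_fieldSeries (c : ℕ → 𝕜) (i : ℕ) :
    coeff (i + 1) (fieldSeries D c) = c i • (D i : R →ₗ[𝕜] R) := coeff_mk _ _

theorem coeff_fieldSeries_mul (c : ℕ → 𝕜) (F : (Module.End 𝕜 R)⟦X⟧) (k : ℕ) (f : R) :
    coeff k (fieldSeries D c * F) f =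
      ∑ i ∈ range k, c i • D i (coeff (k - (i + 1)) F f) := by
  rw [coeff_mul, Nat.sum_antidiagonal_eq_sum_range_succ_mk, sum_range_succ',
    coeff_zero_fieldSeries, zero_mul, add_zero, LinearMap.sum_apply]
  refine sum_congr rfl fun i _ => ?_
  rw [coeff_succ_fieldSeries]
  rfl

theorem commute_fieldSeries (hD : ∀ i j f, D i (D j f) = D j (D i f)) (c d : ℕ → 𝕜) :
    Commute (fieldSeries D c) (fieldSeries D d) := by
  have h : ∀ a b, coeff a (fieldSeries D c) * coeff b (fieldSeries D d) =
      coeff b (fieldSeries D d) * coeff a (fieldSeries D c) := by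
    rintro (_ | a) (_ | b)
    · rw [coeff_zero_fieldSeries, coeff_zero_fieldSeries]
    · rw [coeff_zero_fieldSeries, zero_mul, mul_zero]
    · rw [coeff_zero_fieldSeries, zero_mul, mul_zero]
    · rw [coeff_succ_fieldSeries, coeff_succ_fieldSeries]
      ext f
      simp only [Module.End.mul_apply, LinearMap.smul_apply, Derivation.coeFn_coe,
        Derivation.map_smul, hD a b, smul_comm (c a)]
  ext1 k
  rw [coeff_mul, coeff_mul, ← Nat.sum_antidiagonal_swap]
  exact sum_congr rfl fun p _ => h _ _

/-- The series `∑ᵢ sⁱ⁺¹ / (i+1) ∂ᵢ`. -/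
abbrev miwaSeries : (Module.End 𝕜 R)⟦X⟧ := fieldSeries D fun i => ((i + 1 : ℕ) : 𝕜)⁻¹

theorem coeff_miwaSeries_pow_eq_zero {m k : ℕ} (h : k < m) :
    coeff k (miwaSeries D ^ m) = 0 := by
  induction m generalizing k with
  | zero => omega
  | succ m ih =>
    ext f
    rw [pow_succ', coeff_fieldSeries_mul, sum_eq_zero]
    · rfl
    · intro i hi
      rw [mem_range] at hi
      rw [ih (by omega)]
      simp

/-- The exponential `exp(ε ∑ᵢ sⁱ⁺¹ / (i+1) ∂ᵢ)`. -/
def shiftSeries (ε : 𝕜) : (Module.End 𝕜 R)⟦X⟧ :=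
  PowerSeries.mk fun k => ∑ m ∈ range (k + 1),
    (ε ^ m / (m.factorial : 𝕜)) • coeff k (miwaSeries D ^ m)

theorem coeff_shiftSeries (ε : 𝕜) (k : ℕ) : coeff k (shiftSeries D ε) =
    ∑ m ∈ range (k + 1), (ε ^ m / (m.factorial : 𝕜)) • coeff k (miwaSeries D ^ m) := coeff_mk _ _

theorem coeff_shiftSeries_of_lt (ε : 𝕜) {k N : ℕ} (h : k < N) : coeff k (shiftSeries D ε) =
    ∑ m ∈ range N, (ε ^ m / (m.factorial : 𝕜)) • coeff k (miwaSeries D ^ m) := by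
  rw [coeff_shiftSeries]
  refine sum_subset (range_subset_range.2 (by omega)) fun m _ hm => ?_
  rw [mem_range] at hm
  rw [coeff_miwaSeries_pow_eq_zero D (by omega), smul_zero]

theorem coeff_zero_shiftSeries (ε : 𝕜) : coeff 0 (shiftSeries D ε) = 1 := by
  rw [coeff_shiftSeries]
  simp

theorem coeff_mul_shiftSeries (ε : 𝕜) (F : (Module.End 𝕜 R)⟦X⟧) {k N : ℕ} (h : k < N) :
    coeff k (F * shiftSeries D ε) =
      ∑ m ∈ range N, (ε ^ m / (m.factorial : 𝕜)) • coeff k (F * miwaSeries D ^ m) := by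
  simp only [coeff_mul, smul_sum]
  rw [sum_comm]
  refine sum_congr rfl fun p hp => ?_
  rw [coeff_shiftSeries_of_lt D ε (N := N) (by have := HasAntidiagonal.mem_antidiagonal.1 hp; omega), mul_sum]
  simp only [mul_smul_comm]

theorem coeff_shiftSeries_mul (ε : 𝕜) (F : (Module.End 𝕜 R)⟦X⟧) {k N : ℕ} (h : k < N) :
    coeff k (shiftSeries D ε * F) =
      ∑ m ∈ range N, (ε ^ m / (m.factorial : 𝕜)) • coeff k (miwaSeries D ^ m * F) := by
  simp only [coeff_mul, smul_sum]
  rw [sum_comm]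
  refine sum_congr rfl fun p hp => ?_
  rw [coeff_shiftSeries_of_lt D ε (N := N) (by have := HasAntidiagonal.mem_antidiagonal.1 hp; omega), sum_mul]
  simp only [smul_mul_assoc]

theorem commute_shiftSeries (hD : ∀ i j f, D i (D j f) = D j (D i f)) (ε : 𝕜) (c : ℕ → 𝕜) :
    Commute (fieldSeries D c) (shiftSeries D ε) := by
  ext1 k
  rw [coeff_mul_shiftSeries D ε _ k.lt_succ_self, coeff_shiftSeries_mul D ε _ k.lt_succ_self]
  refine sum_congr rfl fun m _ => ?_
  rw [((commute_fieldSeries D hD c _).pow_right m).eq]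

theorem euler_miwaSeries [CharZero 𝕜] : euler (miwaSeries D) = fieldSeries D 1 := by
  ext1 k
  rw [coeff_euler]
  rcases k with _ | k
  · rw [coeff_zero_fieldSeries, coeff_zero_fieldSeries, smul_zero]
  · rw [coeff_succ_fieldSeries, coeff_succ_fieldSeries, ← Nat.cast_smul_eq_nsmul 𝕜, smul_smul,
      mul_inv_cancel₀ (Nat.cast_ne_zero.2 k.succ_ne_zero)]
    rfl

/-- The differential equation `s d/ds exp(εA) = ε (s dA/ds) exp(εA)`, valid because `A` commutes
with `s dA/ds = ∑ sⁱ⁺¹ ∂ᵢ`. Differentiation sends the `(m+1)`-st exponential term to the `m`-th. -/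
theorem euler_shiftSeries [CharZero 𝕜] (hD : ∀ i j f, D i (D j f) = D j (D i f)) (ε : 𝕜) (k : ℕ) :
    coeff k (euler (shiftSeries D ε)) = ε • coeff k (fieldSeries D 1 * shiftSeries D ε) := by
  rw [coeff_mul_shiftSeries D ε _ k.lt_succ_self, sum_range_succ, coeff_euler, coeff_shiftSeries,
    sum_range_succ']
  -- The unmatched last term on the right: neither factor has a constant term, so the product is
  -- divisible by `sᵏ⁺¹`.
  have hk : coeff k (fieldSeries D 1 * miwaSeries D ^ k) = 0 := by
    rw [((commute_fieldSeries D hD 1 _).pow_right k).eq, coeff_mul, sum_eq_zero]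
    intro p hp
    rcases Nat.lt_or_ge p.1 k with h | h
    · rw [coeff_miwaSeries_pow_eq_zero D h, zero_mul]
    · have : p.2 = 0 := by have := HasAntidiagonal.mem_antidiagonal.1 hp; omega
      rw [this, coeff_zero_fieldSeries, mul_zero]
  have h0 : k • coeff k (miwaSeries D ^ 0) = 0 := by
    rw [pow_zero, coeff_one]
    split_ifs with h
    · simp [h]
    · simp
  rw [hk, smul_zero, add_zero, smul_add, smul_comm k, h0, smul_zero, add_zero, smul_sum, smul_sum]
  refine sum_congr rfl fun m _ => ?_
  rw [smul_comm k, ← coeff_euler,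
    euler_pow (commute_fieldSeries D hD _ _) (euler_miwaSeries D), map_nsmul,
    ← Nat.cast_smul_eq_nsmul 𝕜, smul_smul, smul_smul, Nat.factorial_succ]
  congr 1
  have h1 : ((m + 1 : ℕ) : 𝕜) ≠ 0 := Nat.cast_ne_zero.2 m.succ_ne_zero
  have h2 : (m.factorial : 𝕜) ≠ 0 := Nat.cast_ne_zero.2 m.factorial_ne_zero
  rw [Nat.cast_mul]
  field_simp
  ring

/-- The product has zero Euler derivative and constant term `1`; in characteristic zero this forces
it to be `1`. -/
theorem shiftSeries_mul_shiftSeries_neg [CharZero 𝕜] (hD : ∀ i j f, D i (D j f) = D j (D i f))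
    (ε : 𝕜) : shiftSeries D ε * shiftSeries D (-ε) = 1 := by
  have key : euler (shiftSeries D ε * shiftSeries D (-ε)) = 0 := by
    have h : ∀ ε : 𝕜, euler (shiftSeries D ε) =
        C (algebraMap 𝕜 (Module.End 𝕜 R) ε) * (fieldSeries D 1 * shiftSeries D ε) := fun ε => by
      ext1 k
      rw [euler_shiftSeries D hD, coeff_C_mul, Algebra.smul_def]
    have hc : Commute (shiftSeries D ε) (C (algebraMap 𝕜 (Module.End 𝕜 R) (-ε))) := by
      ext1 k
      rw [coeff_C_mul, coeff_mul_C]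
      exact (Algebra.commutes _ _).symm
    rw [euler_mul, h, h, ← mul_assoc (shiftSeries D ε), hc.eq, mul_assoc (C _) (shiftSeries D ε),
      ← mul_assoc (shiftSeries D ε), ← (commute_shiftSeries D hD ε 1).eq, mul_assoc (C _),
      mul_assoc, ← add_mul, ← map_add, ← map_add, add_neg_cancel, map_zero, map_zero, zero_mul]
  ext1 k
  rcases k with _ | k
  · simp [coeff_mul, coeff_zero_shiftSeries]
  · have := congrArg (coeff (k + 1)) key
    rw [coeff_euler, map_zero, ← Nat.cast_smul_eq_nsmul 𝕜] at this
    rw [(smul_eq_zero.1 this).resolve_left (Nat.cast_ne_zero.2 k.succ_ne_zero), coeff_one,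
      if_neg k.succ_ne_zero]

/-- The action of `∑ᵢ sⁱ⁺¹ ∂ᵢ` on power series. -/
def flow (F : R⟦X⟧) : R⟦X⟧ :=
  PowerSeries.mk fun k => ∑ p ∈ antidiagonal k, coeff p.1 (fieldSeries D 1) (coeff p.2 F)

theorem fieldSeries_leibniz (a : ℕ) (f g : R) : coeff a (fieldSeries D 1) (f * g) =
    coeff a (fieldSeries D 1) f * g + f * coeff a (fieldSeries D 1) g := by
  rcases a with _ | a
  · simp [coeff_zero_fieldSeries]
  · rw [coeff_succ_fieldSeries, Pi.one_apply, one_smul]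
    simp only [Derivation.coeFn_coe, Derivation.leibniz, smul_eq_mul]
    ring

/-- The flow inherits the Leibniz rule from the derivations `D i`, so products of solutions of the
shift equation are again solutions. -/
theorem flow_mul (F G : R⟦X⟧) : flow D (F * G) = flow D F * G + F * flow D G := by
  ext k
  simp only [flow, map_add, coeff_mk, coeff_mul, map_sum, fieldSeries_leibniz, sum_add_distrib,
    sum_mul, mul_sum]
  congr 1
  · exact sum_antidiagonal_assoc
      (fun a b c => coeff a (fieldSeries D 1) (coeff b F) * coeff c G) k
  · rw [sum_antidiagonal_assoc
      (fun a b c => coeff b F * coeff a (fieldSeries D 1) (coeff c G)) k,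
      sum_antidiagonal_assoc
      (fun b a c => coeff b F * coeff a (fieldSeries D 1) (coeff c G)) k]
    refine sum_congr rfl fun p _ => ?_
    rw [← Nat.sum_antidiagonal_swap]
    rfl

/-- Uniqueness for the shift equation: `fieldSeries D 1` has no constant term, so the coefficient `k
+ 1` of the flow depends only on earlier coefficients, and `k + 1` is invertible in `𝕜`. -/
theorem eq_of_euler_eq_flow [CharZero 𝕜] {ε : 𝕜} {F G : R⟦X⟧}
    (hF : ∀ k, coeff k (euler F) = ε • coeff k (flow D F))
    (hG : ∀ k, coeff k (euler G) = ε • coeff k (flow D G))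
    (h0 : coeff 0 F = coeff 0 G) : F = G := by
  ext k
  induction k using Nat.strong_induction_on with
  | _ k ih =>
    rcases k with _ | k
    · exact h0
    · have h : coeff (k + 1) (flow D F) = coeff (k + 1) (flow D G) := by
        rw [flow, flow, coeff_mk, coeff_mk]
        refine sum_congr rfl fun p hp => ?_
        rcases Nat.eq_zero_or_pos p.1 with h | h
        · rw [h, coeff_zero_fieldSeries]
          rfl
        · rw [ih p.2 (by have := HasAntidiagonal.mem_antidiagonal.1 hp; omega)]
      have h1 := hF (k + 1)
      rw [h, ← hG (k + 1), coeff_euler, coeff_euler, ← Nat.cast_smul_eq_nsmul 𝕜,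
        ← Nat.cast_smul_eq_nsmul 𝕜] at h1
      exact smul_right_injective R (Nat.cast_ne_zero (R := 𝕜).2 k.succ_ne_zero) h1

/-- The values of the exponential at an element of the ring. -/
def shiftFun (ε : 𝕜) (f : R) : R⟦X⟧ := PowerSeries.mk fun k => coeff k (shiftSeries D ε) f

theorem coeff_shiftFun (ε : 𝕜) (f : R) (k : ℕ) :
    coeff k (shiftFun D ε f) = coeff k (shiftSeries D ε) f := by
  rw [shiftFun, coeff_mk]

theorem euler_shiftFun [CharZero 𝕜] (hD : ∀ i j f, D i (D j f) = D j (D i f))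
    (ε : 𝕜) (f : R) (k : ℕ) :
    coeff k (euler (shiftFun D ε f)) = ε • coeff k (flow D (shiftFun D ε f)) := by
  have h := LinearMap.congr_fun (euler_shiftSeries D hD ε k) f
  rw [coeff_euler] at h ⊢
  rw [coeff_shiftFun]
  refine h.trans ?_
  rw [LinearMap.smul_apply, coeff_mul, flow, coeff_mk, LinearMap.sum_apply]
  simp only [coeff_shiftFun]
  rfl

/-- Both sides solve the same shift equation, by the Leibniz rules for `euler` and `flow`, and have
the same constant term. -/
theorem shiftFun_mul [CharZero 𝕜] (hD : ∀ i j f, D i (D j f) = D j (D i f))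
    (ε : 𝕜) (f g : R) :
    shiftFun D ε (f * g) = shiftFun D ε f * shiftFun D ε g := by
  refine eq_of_euler_eq_flow D (euler_shiftFun D hD ε _) (fun k => ?_) ?_
  · rw [euler_mul, flow_mul, map_add, map_add, smul_add, coeff_mul, coeff_mul, coeff_mul, coeff_mul,
      smul_sum, smul_sum]
    simp only [euler_shiftFun D hD, smul_mul_assoc, mul_smul_comm]
  · rw [coeff_mul, HasAntidiagonal.antidiagonal_zero, sum_singleton]
    simp only [coeff_shiftFun, coeff_zero_shiftSeries, Module.End.one_apply]

theorem shiftFun_one [CharZero 𝕜] (hD : ∀ i j f, D i (D j f) = D j (D i f))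
    (ε : 𝕜) : shiftFun D ε 1 = 1 := by
  refine eq_of_euler_eq_flow D (euler_shiftFun D hD ε _) (fun k => ?_) ?_
  · rw [← map_one C, euler_C, map_zero, flow, coeff_mk, sum_eq_zero, smul_zero]
    rintro ⟨_ | a, b⟩ _
    · rw [coeff_zero_fieldSeries]; rfl
    · rw [coeff_succ_fieldSeries, coeff_C]
      split_ifs <;> simp
  · simp [coeff_shiftFun, coeff_zero_shiftSeries]

variable [CharZero 𝕜] (hD : ∀ i j f, D i (D j f) = D j (D i f))

/-- The formal shift `f ↦ f(t + ε[s])` as a ring homomorphism. -/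
def shiftHom (ε : 𝕜) : R →+* R⟦X⟧ where
  toFun := shiftFun D ε
  map_one' := shiftFun_one D hD ε
  map_mul' := shiftFun_mul D hD ε
  map_zero' := by ext k; simp [coeff_shiftFun]
  map_add' f g := by ext k; simp [coeff_shiftFun]

theorem coeff_shiftHom (ε : 𝕜) (f : R) (k : ℕ) :
    coeff k (shiftHom D hD ε f) = coeff k (shiftSeries D ε) f := coeff_shiftFun D ε f k

theorem coeff_zero_shiftHom (ε : 𝕜) (f : R) : coeff 0 (shiftHom D hD ε f) = f := by
  rw [coeff_shiftHom, coeff_zero_shiftSeries]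
  rfl

/-- With the two shift variables set equal, `f(t - ε[s] + ε[s]) = f(t)`; coefficientwise this is
`shiftSeries_mul_shiftSeries_neg`. -/
theorem diag_map_shiftHom (ε : 𝕜) (f : R) :
    diag (PowerSeries.map (shiftHom D hD ε) (shiftHom D hD (-ε) f)) = C f := by
  ext1 k
  have h := LinearMap.congr_fun (congrArg (coeff k) (shiftSeries_mul_shiftSeries_neg D hD ε)) f
  rw [coeff_mul, LinearMap.sum_apply] at h
  rw [coeff_diag]
  simp only [coeff_map, coeff_shiftHom]
  refine h.trans ?_
  rw [coeff_one, coeff_C]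
  split_ifs <;> rfl

/-- The recursion for the coefficients of the formal shift. -/
theorem succ_smul_coeff_shiftHom (ε : 𝕜) (f : R) (k : ℕ) :
    (k + 1) • coeff (k + 1) (shiftHom D hD ε f) =
      ε • ∑ i ∈ range (k + 1), D i (coeff (k - i) (shiftHom D hD ε f)) := by
  have h := LinearMap.congr_fun (euler_shiftSeries D hD ε (k + 1)) f
  rw [coeff_euler, LinearMap.smul_apply, LinearMap.smul_apply, coeff_fieldSeries_mul] at h
  rw [coeff_shiftHom, h]
  simp only [Pi.one_apply, one_smul, Nat.add_sub_add_right, coeff_shiftHom]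

end Shift

end DmKP

/-! ### From the Sato equations to the linear equation for the shifted wave function. -/

namespace DmKP

open PowerSeries

section Sato

variable {𝕜 R : Type*} [Field 𝕜] [CommRing R] [Algebra 𝕜 R]

theorem npowRec_conj_mul {Z Zinv : PsDiff R} (hinv : Zinv * Z = 1) (k : ℕ) :
    npowRec k (Z * PsDiff.deltaPow 1 * Zinv) * Z = Z * PsDiff.deltaPow k := by
  induction k with
  | zero => exact (one_mul Z).trans (mul_one Z).symm
  | succ k ih =>
    rw [npowRec, mul_assoc, mul_assoc (Z * _), hinv, mul_one, ← mul_assoc, ih, mul_assoc,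
      PsDiff.deltaPow_add, Nat.cast_succ]

theorem PsDiff.mapCoeff_one (d : Derivation 𝕜 R R) :
    PsDiff.mapCoeff (d : R →+ R) (1 : PsDiff R) = 0 := by
  ext m n
  change d ((1 : PsDiff R).coeff m n) = 0
  rw [PsDiff.coeff_one]
  dsimp only
  split_ifs <;> simp

theorem PsDiff.IsPos.mapCoeff {a : PsDiff R} (ha : a.IsPos) (d : R →+ R) :
    (PsDiff.mapCoeff d a).IsPos := fun k hk => funext fun n => by
  change d (a.coeff k n) = 0
  rw [ha k hk]
  exact map_zero d

theorem PsDiff.isPos_sub_nonpos (a : PsDiff R) : (a - a.nonpos).IsPos := fun k hk => by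
  rw [PsDiff.coeff_sub]
  change a.coeff k - (if k ≤ 0 then a.coeff k else 0) = 0
  rw [if_pos hk, sub_self]

variable (D : ℕ → Derivation 𝕜 R R)

/-- `Lⁱ Z = Z Δⁱ` turns `-(Lⁱ)_{≤0} Z` into `(Lⁱ)_{>0} Z - Z Δⁱ`; thus `M` is the positive part of
the power of `L`. -/
theorem sato_pos {Z Zinv : PsDiff R} (hinv : Zinv * Z = 1)
    (sato : ∀ i : ℕ, PsDiff.mapCoeff (D i : R →+ R) Z =
      -((npowRec (i + 1) (Z * PsDiff.deltaPow 1 * Zinv)).nonpos * Z)) (i : ℕ) :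
    ∃ M : PsDiff R, M.IsPos ∧
      PsDiff.mapCoeff (D i : R →+ R) Z + Z * PsDiff.deltaPow (i + 1 : ℕ) = M * Z :=
  ⟨_, PsDiff.isPos_sub_nonpos (npowRec (i + 1) (Z * PsDiff.deltaPow 1 * Zinv)), by
    rw [sato, sub_mul, npowRec_conj_mul hinv, neg_add_eq_sub]⟩

variable [CharZero 𝕜] (hD : ∀ i j f, D i (D j f) = D j (D i f))

/-- The coefficient of `sᵏ` in the operator shifted by `-[s]`. -/
def shiftedOp (k : ℕ) (Z : PsDiff R) : PsDiff R :=
  PsDiff.mapCoeff ((coeff k).toAddMonoidHom.comp (shiftHom D hD (-1) : R →+ R⟦X⟧)) Z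

theorem coeff_shiftedOp (k : ℕ) (Z : PsDiff R) (m n : ℤ) :
    (shiftedOp D hD k Z).coeff m n = coeff k (shiftHom D hD (-1) (Z.coeff m n)) := rfl

theorem shiftedOp_zero (Z : PsDiff R) : shiftedOp D hD 0 Z = Z := by
  ext m n
  rw [coeff_shiftedOp, coeff_zero_shiftHom]

theorem succ_smul_shiftedOp (k : ℕ) (Z : PsDiff R) :
    (k + 1) • shiftedOp D hD (k + 1) Z =
      -∑ i ∈ Finset.range (k + 1), PsDiff.mapCoeff (D i : R →+ R) (shiftedOp D hD (k - i) Z) := by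
  ext m n
  rw [PsDiff.coeff_nsmul, PsDiff.coeff_neg, Pi.smul_apply, Pi.smul_apply, Pi.neg_apply, Pi.neg_apply,
    PsDiff.coeff_sum, coeff_shiftedOp, succ_smul_coeff_shiftHom, neg_one_smul]
  rfl

/-- The coefficients of `Z(t - [s]) (1 - s Δ)`. -/
def shiftedWave (Z : PsDiff R) : ℕ → PsDiff R
  | 0 => Z
  | k + 1 => shiftedOp D hD (k + 1) Z - shiftedOp D hD k Z * PsDiff.deltaPow 1

theorem mapCoeff_sub {S : Type*} [CommRing S] (d : R →+ S) (a b : PsDiff R) :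
    PsDiff.mapCoeff d (a - b) = PsDiff.mapCoeff d a - PsDiff.mapCoeff d b := by
  ext m n
  change d ((a - b).coeff m n) = _
  rw [PsDiff.coeff_sub, PsDiff.coeff_sub]
  exact map_sub d _ _

theorem mapCoeff_mul_deltaPow (d : R →+ R) (a : PsDiff R) (j : ℤ) :
    PsDiff.mapCoeff d (a * PsDiff.deltaPow j) = PsDiff.mapCoeff d a * PsDiff.deltaPow j := by
  ext m n
  rw [PsDiff.mul_deltaPow_coeff]
  change d ((a * PsDiff.deltaPow j).coeff m n) = _
  rw [PsDiff.mul_deltaPow_coeff]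
  rfl

/-- The equation `s d/ds G = -∑ sⁱ (∂ᵢG + G Δⁱ)`, `i ≥ 1`, for `G = Z(t - [s]) (1 - sΔ)`: the shift
contributes `∂ᵢ`, and the logarithmic derivative of `1 - sΔ` contributes the powers of `Δ`. -/
theorem succ_smul_shiftedWave (k : ℕ) (Z : PsDiff R) :
    (k + 1) • shiftedWave D hD Z (k + 1) = -∑ i ∈ Finset.range (k + 1),
      (PsDiff.mapCoeff (D i : R →+ R) (shiftedWave D hD Z (k - i)) +
        shiftedWave D hD Z (k - i) * PsDiff.deltaPow (i + 1 : ℕ)) := by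
  set F := fun k => shiftedOp D hD k Z with hF
  have hlast : ∀ i ∈ Finset.range k, shiftedWave D hD Z (k - i) =
      F (k - i) - F (k - (i + 1)) * PsDiff.deltaPow 1 := fun i hi => by
    rw [Finset.mem_range] at hi
    obtain ⟨j, hj⟩ : ∃ j, k - i = j + 1 := ⟨k - i - 1, by omega⟩
    rw [hj, shiftedWave, show k - (i + 1) = j by omega]
  have h0 : shiftedWave D hD Z (k - k) = F (k - k) := by
    rw [Nat.sub_self, shiftedWave, hF]
    exact (shiftedOp_zero D hD Z).symm
  have h1 : ∑ i ∈ Finset.range (k + 1), PsDiff.mapCoeff (D i : R →+ R) (shiftedWave D hD Z (k - i)) =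
      ∑ i ∈ Finset.range (k + 1), PsDiff.mapCoeff (D i : R →+ R) (F (k - i)) +
        (k • F k) * PsDiff.deltaPow 1 := by
    have h2 : k • F k = -∑ i ∈ Finset.range k, PsDiff.mapCoeff (D i : R →+ R) (F (k - (i + 1))) := by
      rcases k with _ | k
      · simp
      · rw [hF]
        simp only [succ_smul_shiftedOp, Nat.add_sub_add_right]
    rw [h2, neg_mul, Finset.sum_mul, Finset.sum_range_succ, Finset.sum_range_succ, h0,
      add_right_comm, ← sub_eq_add_neg, ← Finset.sum_sub_distrib]
    congr 1
    refine Finset.sum_congr rfl fun i hi => ?_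
    rw [hlast i hi, mapCoeff_sub, mapCoeff_mul_deltaPow]
  have h3 : ∑ i ∈ Finset.range (k + 1), shiftedWave D hD Z (k - i) * PsDiff.deltaPow (i + 1 : ℕ) =
      F k * PsDiff.deltaPow 1 := by
    -- Multiplying `1 - sΔ` by the geometric series in `sΔ`: the sum telescopes to its first term.
    have h4 : ∀ i ∈ Finset.range k, shiftedWave D hD Z (k - i) * PsDiff.deltaPow (i + 1 : ℕ) =
        F (k - i) * PsDiff.deltaPow (i + 1 : ℕ) -
          F (k - (i + 1)) * PsDiff.deltaPow (i + 1 + 1 : ℕ) := fun i hi => by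
      rw [hlast i hi, sub_mul, mul_assoc, PsDiff.deltaPow_add, add_comm (1 : ℤ), ← Nat.cast_succ]
    rw [Finset.sum_range_succ, Finset.sum_congr rfl h4, h0,
      Finset.sum_range_sub' (fun i => F (k - i) * PsDiff.deltaPow (i + 1 : ℕ)), sub_add_cancel]
    simp
  rw [Finset.sum_add_distrib, h1, h3, shiftedWave, smul_sub, succ_smul_shiftedOp, add_smul, one_smul]
  simp only [hF, smul_mul_assoc]
  abel

/-- If `G = E Z`, then `∂ᵢG + G Δⁱ = (∂ᵢE + E M) Z` with `M` positive by `sato_pos`. Starting from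
`E = 1`, the recursion for `G` therefore produces only positive operators. -/
theorem exists_shiftedWave_eq_mul {Z Zinv : PsDiff R} (hinv : Zinv * Z = 1)
    (sato : ∀ i : ℕ, PsDiff.mapCoeff (D i : R →+ R) Z =
      -((npowRec (i + 1) (Z * PsDiff.deltaPow 1 * Zinv)).nonpos * Z)) (k : ℕ) :
    ∃ E : PsDiff R, ((k = 0 ∧ E = 1) ∨ E.IsPos) ∧ shiftedWave D hD Z k = E * Z := by
  induction k using Nat.strong_induction_on with
  | _ k ih =>
    rcases k with _ | k
    · exact ⟨1, Or.inl ⟨rfl, rfl⟩, (one_mul Z).symm⟩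
    · have step : ∀ i ∈ Finset.range (k + 1), ∃ E : PsDiff R, E.IsPos ∧
          PsDiff.mapCoeff (D i : R →+ R) (shiftedWave D hD Z (k - i)) +
            shiftedWave D hD Z (k - i) * PsDiff.deltaPow (i + 1 : ℕ) = E * Z := fun i _ => by
        obtain ⟨E, hE, hEZ⟩ := ih (k - i) (by omega)
        obtain ⟨M, hM, hMZ⟩ := sato_pos D hinv sato i
        refine ⟨PsDiff.mapCoeff (D i : R →+ R) E + E * M, PsDiff.IsPos.add ?_ ?_, ?_⟩
        · rcases hE with ⟨-, rfl⟩ | hE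
          · rw [PsDiff.mapCoeff_one]
            exact PsDiff.isPos_zero
          · exact hE.mapCoeff _
        · rcases hE with ⟨-, rfl⟩ | hE
          · rwa [one_mul]
          · exact PsDiff.isPos_mul (fun j hj => hE j hj.le) hM
        · rw [hEZ, PsDiff.mapCoeff_derivation_mul, add_assoc, mul_assoc, ← mul_add, hMZ, add_mul,
            mul_assoc]
      choose! E hE hEZ using step
      have hsum : (k + 1) • shiftedWave D hD Z (k + 1) =
          -(∑ i ∈ Finset.range (k + 1), E i) * Z := by
        rw [succ_smul_shiftedWave, Finset.sum_congr rfl hEZ, ← Finset.sum_mul, neg_mul]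
      refine ⟨PsDiff.ofFun (fun _ => algebraMap 𝕜 R ((k + 1 : ℕ) : 𝕜)⁻¹) *
        -(∑ i ∈ Finset.range (k + 1), E i), Or.inr fun j hj => ?_, ?_⟩
      · funext n
        rw [PsDiff.ofFun_mul_coeff, PsDiff.coeff_neg, Pi.neg_apply, PsDiff.IsPos.sum hE j hj]
        simp
      · ext m n
        rw [mul_assoc, ← hsum, PsDiff.ofFun_mul_coeff, PsDiff.coeff_nsmul, Pi.smul_apply,
          Pi.smul_apply, ← Algebra.smul_def, ← Nat.cast_smul_eq_nsmul 𝕜, smul_smul,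
          inv_mul_cancel₀ (Nat.cast_ne_zero.2 k.succ_ne_zero), one_smul]

/-- `Z(t - [s]) (1 - s Δ) = (1 + e Δ) Z`. -/
theorem exists_shift_eq {Z Zinv : PsDiff R} (hZ : ∀ k, 0 < k → Z.coeff k = 0)
    (hZ0 : ∀ n, IsUnit (Z.coeff 0 n)) (hinv : Zinv * Z = 1)
    (sato : ∀ i : ℕ, PsDiff.mapCoeff (D i : R →+ R) Z =
      -((npowRec (i + 1) (Z * PsDiff.deltaPow 1 * Zinv)).nonpos * Z)) :
    ∃ e : ℤ → R⟦X⟧, ∀ p n : ℤ, shiftHom D hD (-1) (Z.coeff p n) -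
      X * shiftHom D hD (-1) (Z.coeff (p - 1) n) =
        C (Z.coeff p n) + e n * C (PsDiff.deltaStep Z.coeff p n) := by
  have key : ∀ k : ℕ, ∃ e : ℤ → R, ∀ p n : ℤ,
      (shiftedWave D hD Z (k + 1)).coeff p n = e n * PsDiff.deltaStep Z.coeff p n := fun k => by
    obtain ⟨E, hE, hEZ⟩ := exists_shiftedWave_eq_mul D hD hinv sato (k + 1)
    have hE := hE.resolve_left fun h => k.succ_ne_zero h.1
    -- The other bound on `E`: `Z(t - [s]) (1 - sΔ)` has order at most one, and `Z` has order zero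
    -- with invertible leading coefficient. Hence only the coefficient of `Δ` remains.
    have hE1 := PsDiff.coeff_eq_zero_of_mul (M := 1) hZ hZ0 (a := E) fun m hm => by
      have hz : ∀ i : ℤ, 0 < i → ∀ j n, coeff j (shiftHom D hD (-1) (Z.coeff i n)) = 0 :=
        fun i hi j n => by rw [hZ i hi, Pi.zero_apply, map_zero, map_zero]
      funext n
      rw [← hEZ, shiftedWave, PsDiff.coeff_sub, Pi.sub_apply, Pi.sub_apply,
        PsDiff.mul_deltaPow_coeff, coeff_shiftedOp, coeff_shiftedOp, hz m (by omega),
        hz (m - 1) (by omega)]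
      simp
    refine ⟨E.coeff 1, fun p n => ?_⟩
    rw [hEZ, PsDiff.mul_coeff_of_single (j := 1) fun j hj => ?_, PsDiff.deltaMul_one]
    rcases lt_or_gt_of_ne hj with h | h
    · exact hE j (by omega)
    · exact hE1 j h
  choose e he using key
  -- No constant term in `s`, since at `s = 0` the operator is `Z` itself.
  refine ⟨fun n => PowerSeries.mk fun | 0 => 0 | k + 1 => e k n, fun p n => ?_⟩
  ext k
  rcases k with _ | k
  · rw [map_sub, map_add, coeff_zero_shiftHom, coeff_mul_C, coeff_mk, coeff_zero_X_mul, coeff_C]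
    simp
  · rw [map_sub, map_add, coeff_mul_C, coeff_mk, coeff_succ_X_mul, coeff_C, if_neg k.succ_ne_zero,
      zero_add, ← he, shiftedWave, PsDiff.coeff_sub, Pi.sub_apply, Pi.sub_apply,
      PsDiff.mul_deltaPow_coeff]
    rfl

/-- The linear equation for the wave function shifted by `-[s]`. -/
theorem exists_shift_wave_eq {Z Zinv : PsDiff R} (hZ : ∀ k, 0 < k → Z.coeff k = 0)
    (hZ0 : ∀ n, IsUnit (Z.coeff 0 n)) (hinv : Zinv * Z = 1)
    (sato : ∀ i : ℕ, PsDiff.mapCoeff (D i : R →+ R) Z =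
      -((npowRec (i + 1) (Z * PsDiff.deltaPow 1 * Zinv)).nonpos * Z))
    {W : ℤ → R⟦X⟧} (hW : ∀ n j, coeff j (W n) = Z.coeff (-(j : ℤ)) n) :
    ∃ e : ℤ → R⟦X⟧, ∀ n : ℤ,
      (X - C X) * PowerSeries.map (shiftHom D hD (-1)) (W n) =
        X * PowerSeries.map C (W n) + C (e n) *
          ((1 + X) * PowerSeries.map C (W (n + 1)) - X * PowerSeries.map C (W n)) := by
  obtain ⟨e, he⟩ := exists_shift_eq D hD hZ hZ0 hinv sato
  refine ⟨e, fun n => ?_⟩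
  -- The outer `X` is `λ⁻¹` and `C X` is `s`. The equation has been multiplied by `X`, so its
  -- coefficient at `j` is the operator identity at `p = 1 - j`.
  ext1 j
  simp only [sub_mul, add_mul, one_mul, map_sub, map_add, coeff_C_mul, coeff_map]
  rcases j with _ | j
  · have h := he 1 n
    rw [PsDiff.deltaStep, hZ 1 one_pos, Pi.zero_apply, Pi.zero_apply, map_zero, map_zero,
      sub_self] at h
    simp only [coeff_zero_X_mul, hW, Nat.cast_zero, neg_zero]
    simpa using h
  · have h := he (-(j : ℤ)) n
    simp only [coeff_succ_X_mul, coeff_map, hW]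
    have hj : -((j + 1 : ℕ) : ℤ) = -(j : ℤ) - 1 := by push_cast; ring
    rw [hj, h, PsDiff.deltaStep]
    simp only [map_add, map_sub]
    ring

end Sato

end DmKP

/-! ### Bilinear relations for the tau functions. -/

namespace DmKP

open PowerSeries

section Fay

variable {R : Type*} [CommRing R] {T : R →+* R⟦X⟧} {τ₀ τ₁ : ℤ → R} {W e : ℤ → R⟦X⟧}

/-- The relation between the two tau functions at neighbouring sites. -/
theorem tau_site_relation (hT : ∀ f, coeff 0 (T f) = f) (h₀ : ∀ n, IsUnit (τ₀ n))
    (h₁ : ∀ n, IsUnit (τ₁ n)) (hW : ∀ n, W n * C (τ₁ n) = T (τ₀ n))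
    (hLE : ∀ n, (X - C X) * PowerSeries.map T (W n) =
      X * PowerSeries.map C (W n) + C (e n) *
        ((1 + X) * PowerSeries.map C (W (n + 1)) - X * PowerSeries.map C (W n))) (n : ℤ) :
    e n * C (τ₀ (n + 1)) * T (τ₁ n) = -(X * T (τ₀ n) * C (τ₁ (n + 1))) ∧
    T (τ₁ n) * C (τ₀ (n + 1)) + X * T (τ₀ n) * C (τ₁ (n + 1)) =
      (1 + X) * T (τ₀ (n + 1)) * C (τ₁ n) := by
  have hw : ∀ n, coeff 0 (W n) * τ₁ n = τ₀ n := fun n => by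
    have := congrArg (coeff 0) (hW n)
    rwa [coeff_mul_C, hT] at this
  have hTw : ∀ n, T (coeff 0 (W n)) * T (τ₁ n) = T (τ₀ n) := fun n => by rw [← map_mul, hw]
  have hCw : ∀ n, (C (coeff 0 (W n)) : R⟦X⟧) * C (τ₁ n) = C (τ₀ n) := fun n => by
    rw [← map_mul, hw]
  -- The value at `λ = ∞`, that is, at outer variable zero.
  have lead : -(X * T (coeff 0 (W n))) = e n * C (coeff 0 (W (n + 1))) := by
    have := congrArg (coeff 0) (hLE n)
    simp only [sub_mul, add_mul, one_mul, map_sub, map_add, coeff_C_mul, coeff_zero_X_mul,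
      coeff_map, zero_sub, zero_add, add_zero, sub_zero] at this
    exact this
  -- The value at `λ = s⁻¹`: on the diagonal the factor `X - C X` vanishes, and the left side with
  -- it.
  have dg : 0 = X * W n + e n * ((1 + X) * W (n + 1) - X * W n) := by
    have := congrArg diag (hLE n)
    simp only [map_mul, map_sub, map_add, diag_X, diag_C, diag_map_C, map_one, sub_self,
      zero_mul] at this
    exact this
  have h1 : e n * C (τ₀ (n + 1)) * T (τ₁ n) = -(X * T (τ₀ n) * C (τ₁ (n + 1))) := by
    linear_combination (-(C (τ₁ (n + 1)) * T (τ₁ n))) * lead - e n * T (τ₁ n) * hCw (n + 1)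
      - X * C (τ₁ (n + 1)) * hTw n
  refine ⟨h1, ?_⟩
  have hX : ∀ F G : R⟦X⟧, X * F = X * G → F = G := fun F G h => by
    ext k
    simpa only [coeff_succ_X_mul] using congrArg (coeff (k + 1)) h
  -- After `e` is eliminated by `h1`, every term of `dg` carries a factor `X` and the unit `T (τ₀
  -- n)`, which can be cancelled.
  refine ((h₀ n).map T).mul_left_cancel (((h₁ (n + 1)).map C).mul_left_cancel (hX _ _ ?_))
  linear_combination (-(C (τ₁ n) * C (τ₁ (n + 1)) * C (τ₀ (n + 1)) * T (τ₁ n))) * dg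
    - X * C (τ₁ (n + 1)) * C (τ₀ (n + 1)) * T (τ₁ n) * hW n
    + e n * X * C (τ₁ (n + 1)) * C (τ₀ (n + 1)) * T (τ₁ n) * hW n
    - e n * (1 + X) * C (τ₁ n) * C (τ₀ (n + 1)) * T (τ₁ n) * hW (n + 1)
    - (C (τ₁ n) * (1 + X) * T (τ₀ (n + 1)) - X * T (τ₀ n) * C (τ₁ (n + 1))) * h1

/-- The difference Fay identity with all shifts in the direction `-[s]`. -/
def NegFay (T : R →+* R⟦X⟧) (τ : ℤ → R) (n : ℤ) : Prop :=
  (X - C X) * PowerSeries.map T (T (τ n)) * C (C (τ (n + 1))) =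
    (1 + C X) * X * C (T (τ (n + 1))) * PowerSeries.map C (T (τ n)) -
      C X * (1 + X) * C (T (τ n)) * PowerSeries.map C (T (τ (n + 1)))

/-- The relation between the two tau functions at the same site. -/
def TauRelation (T : R →+* R⟦X⟧) (τ₀ τ₁ : ℤ → R) (n : ℤ) : Prop :=
  X * PowerSeries.map C (T (τ₀ n)) * C (T (τ₁ n)) -
      C X * C (T (τ₀ n)) * PowerSeries.map C (T (τ₁ n)) =
    (X - C X) * C (C (τ₁ n)) * PowerSeries.map T (T (τ₀ n))

/-- Insert `W = T τ₀ / τ₁` into the linear equation. The first site relation eliminates `e`, and the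
second then removes `T τ₁`. -/
theorem negFay_zero (hT : ∀ f, coeff 0 (T f) = f) (h₀ : ∀ n, IsUnit (τ₀ n))
    (h₁ : ∀ n, IsUnit (τ₁ n)) (hW : ∀ n, W n * C (τ₁ n) = T (τ₀ n))
    (hLE : ∀ n, (X - C X) * PowerSeries.map T (W n) =
      X * PowerSeries.map C (W n) + C (e n) *
        ((1 + X) * PowerSeries.map C (W (n + 1)) - X * PowerSeries.map C (W n))) (n : ℤ) :
    NegFay T τ₀ n := by
  obtain ⟨h1, h2⟩ := tau_site_relation hT h₀ h₁ hW hLE n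
  have h1 := congrArg (C (R := R⟦X⟧)) h1
  have h2 := congrArg (C (R := R⟦X⟧)) h2
  have hTW := congrArg (PowerSeries.map T) (hW n)
  have hCW := fun n => congrArg (PowerSeries.map C) (hW n)
  simp only [map_mul, map_add, map_neg, map_one, PowerSeries.map_C] at h1 h2 hTW hCW
  unfold NegFay
  refine (((h₁ (n + 1)).map C).map C).mul_left_cancel
    ((((h₁ n).map C).map C).mul_left_cancel ?_)
  linear_combination C (C (τ₁ n)) * C (C (τ₁ (n + 1))) * C (C (τ₀ (n + 1))) *
      (C (T (τ₁ n)) * hLE n - (X - C X) * hTW)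
    + X * C (C (τ₁ (n + 1))) * C (C (τ₀ (n + 1))) * C (T (τ₁ n)) * hCW n
    + C (e n) * C (C (τ₀ (n + 1))) * C (T (τ₁ n)) *
      ((1 + X) * C (C (τ₁ n)) * hCW (n + 1) - X * C (C (τ₁ (n + 1))) * hCW n)
    + (C (C (τ₁ n)) * (1 + X) * PowerSeries.map C (T (τ₀ (n + 1)))
      - X * PowerSeries.map C (T (τ₀ n)) * C (C (τ₁ (n + 1)))) * h1
    + C (C (τ₁ (n + 1))) * X * PowerSeries.map C (T (τ₀ n)) * h2

/-- The site relation, written in each of the two variables, replaces the shifted `τ₀` at `n + 1` in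
the Fay identity; the two terms containing `τ₁ (n + 1)` cancel. -/
theorem tauRelation_of_negFay {n : ℤ} (h₀ : IsUnit (τ₀ (n + 1)))
    (hB : T (τ₁ n) * C (τ₀ (n + 1)) + X * T (τ₀ n) * C (τ₁ (n + 1)) =
      (1 + X) * T (τ₀ (n + 1)) * C (τ₁ n)) (hF : NegFay T τ₀ n) :
    TauRelation T τ₀ τ₁ n := by
  have h2 := congrArg (C (R := R⟦X⟧)) hB
  have h3 := congrArg (PowerSeries.map C) hB
  unfold NegFay at hF
  unfold TauRelation
  simp only [map_mul, map_add, map_one, PowerSeries.map_C, PowerSeries.map_X] at h2 h3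
  refine ((h₀.map C).map C).mul_left_cancel ?_
  linear_combination (-C (C (τ₁ n))) * hF + X * PowerSeries.map C (T (τ₀ n)) * h2
    - C X * C (T (τ₀ n)) * h3

/-- The site relation, shifted once more in the other variable, is used in both orders of the
variables (`h4` and `h6`). Combining them cancels the doubly shifted `τ₀ n`, and the same-site
relation at `n + 1` produces the remaining term. -/
theorem negFay_one {n : ℤ} (h₀ : ∀ n, IsUnit (τ₀ n))
    (hB : T (τ₁ n) * C (τ₀ (n + 1)) + X * T (τ₀ n) * C (τ₁ (n + 1)) =
      (1 + X) * T (τ₀ (n + 1)) * C (τ₁ n)) (hF : NegFay T τ₀ n)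
    (hA : TauRelation T τ₀ τ₁ (n + 1)) : NegFay T τ₁ n := by
  have h2 := congrArg (C (R := R⟦X⟧)) hB
  have h3 := congrArg (PowerSeries.map C) hB
  have h4 := congrArg (PowerSeries.map T) hB
  unfold NegFay at hF ⊢
  unfold TauRelation at hA
  simp only [map_mul, map_add, map_one, PowerSeries.map_C, PowerSeries.map_X] at h2 h3 h4
  have h5 : (X - C X) * PowerSeries.map T (T (τ₀ n)) * C (C (τ₁ (n + 1))) =
      (1 + X) * C (T (τ₁ n)) * PowerSeries.map C (T (τ₀ (n + 1))) -
        (1 + C X) * PowerSeries.map C (T (τ₁ n)) * C (T (τ₀ (n + 1))) := by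
    refine (((h₀ (n + 1)).map C).map C).mul_left_cancel ?_
    linear_combination C (C (τ₁ (n + 1))) * hF
      - (1 + X) * PowerSeries.map C (T (τ₀ (n + 1))) * h2 + (1 + C X) * C (T (τ₀ (n + 1))) * h3
  -- This is `h4` with the two variables exchanged. It follows algebraically from `h4`, `hA` and
  -- `h5`, without exchanging the order of the two shifts.
  have h6 : PowerSeries.map T (T (τ₁ n)) * PowerSeries.map C (T (τ₀ (n + 1))) +
      C X * PowerSeries.map T (T (τ₀ n)) * PowerSeries.map C (T (τ₁ (n + 1))) =
      (1 + C X) * PowerSeries.map T (T (τ₀ (n + 1))) * PowerSeries.map C (T (τ₁ n)) := by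
    refine (((h₀ (n + 1)).map T).map C).mul_left_cancel ?_
    linear_combination PowerSeries.map C (T (τ₀ (n + 1))) * h4
      - PowerSeries.map T (T (τ₀ n)) * hA - PowerSeries.map T (T (τ₀ (n + 1))) * h5
  refine (((h₀ (n + 1)).map T).map (PowerSeries.map T)).mul_left_cancel ?_
  linear_combination X * C (T (τ₁ (n + 1))) * h6
    - C X * PowerSeries.map C (T (τ₁ (n + 1))) * h4
    - PowerSeries.map T (T (τ₁ n)) * hA

/-- The difference Fay identity, before the passage to the field of fractions. -/
theorem fay_of_negFay {T' : R →+* R⟦X⟧}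
    (hT' : ∀ f, diag (PowerSeries.map T' (T f)) = C f) {τ : ℤ → R} {n : ℤ} (h : NegFay T τ n) :
    (X - C X) * PowerSeries.map C (T (τ n)) * C (T' (τ (n + 1))) =
      (1 + C X) * X * C (C (τ (n + 1))) * PowerSeries.map T' (T (τ n)) -
        C X * (1 + X) * C (C (τ n)) * PowerSeries.map T' (T (τ (n + 1))) := by
  -- The homomorphism `diag.comp (map T')` on the inner series is the substitution `t ↦ t + [s₁]`
  -- with the same `s₁` as the inner variable; it undoes the inner shift `-[s₁]` and adds `[s₁]` to
  -- terms free of it.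
  have hC : ∀ F : R⟦X⟧, PowerSeries.map (diag.comp (PowerSeries.map T')) (PowerSeries.map C F) =
      PowerSeries.map T' F := fun F => by
    ext1 k
    simp only [coeff_map, RingHom.comp_apply, PowerSeries.map_C, diag_C]
  have hTT : ∀ f : R, PowerSeries.map (diag.comp (PowerSeries.map T')) (PowerSeries.map T (T f)) =
      PowerSeries.map C (T f) := fun f => by
    ext1 k
    simp only [coeff_map, RingHom.comp_apply, hT']
  have := congrArg (PowerSeries.map (diag.comp (PowerSeries.map T'))) h
  simpa only [map_mul, map_sub, map_add, map_one, PowerSeries.map_C, PowerSeries.map_X, hC, hTT,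
    RingHom.comp_apply, hT', diag_C, diag_X] using this

end Fay
end DmKP

/-! ### Smooth functions of the times and their commuting derivations. -/

namespace DmKP

section Smooth

variable {𝕜 : Type*} [RCLike 𝕜] {U : Set Times}

theorem extendZero_of_mem (f : U → 𝕜) {t : Times} (h : t ∈ U) : extendZero f t = f ⟨t, h⟩ :=
  dif_pos h

theorem extendZero_add (f g : U → 𝕜) (t : Times) :
    extendZero (f + g) t = extendZero f t + extendZero g t := by
  unfold extendZero; split_ifs <;> simp

theorem extendZero_mul (f g : U → 𝕜) (t : Times) :
    extendZero (f * g) t = extendZero f t * extendZero g t := by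
  unfold extendZero; split_ifs <;> simp

theorem extendZero_inv (f : U → 𝕜) (t : Times) : extendZero f⁻¹ t = (extendZero f t)⁻¹ := by
  unfold extendZero; split_ifs <;> simp

theorem displacement_zero (I : Finset ℕ+) : displacement I 0 = 0 := by
  funext i
  unfold displacement
  split_ifs <;> rfl

theorem displacement_add_smul_single (I : Finset ℕ+) (i : I) (v : I → ℝ) (x : ℝ) :
    displacement I (v + x • Pi.single i 1) = displacement I v + Pi.single (i : ℕ+) x := by
  funext j
  unfold displacement
  by_cases hj : j ∈ I
  · by_cases hij : i = ⟨j, hj⟩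
    · subst hij
      simp [hj]
    · have hij' : (i : ℕ+) ≠ j := fun h => hij (Subtype.ext h)
      simp [hj, Pi.single_eq_of_ne' hij, Pi.single_eq_of_ne' hij']
  · have hij' : (i : ℕ+) ≠ j := fun h => hj (h ▸ i.2)
    simp [hj, Pi.single_eq_of_ne' hij']

/-- A function of the times with indices in `I`, near `t`. -/
abbrev localRep (f : U → 𝕜) (t : U) (I : Finset ℕ+) (v : I → ℝ) : 𝕜 :=
  extendZero f ((t : Times) + displacement I v)

theorem localRep_zero (f : U → 𝕜) (t : U) (I : Finset ℕ+) : localRep f t I 0 = f t := by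
  rw [localRep, displacement_zero, add_zero, extendZero_of_mem f t.2]

/-- By finite openness the displaced point stays in `U` for small `v`, so `pd i f` there is a
directional derivative of the same local representative. This holds on a neighbourhood and can be
differentiated again. -/
theorem eventually_localRep_pd (hU : IsFinOpen U) {f : U → 𝕜} (hf : IsSmooth f) (t : U)
    (I : Finset ℕ+) (i : I) :
    localRep (pd i f) t I =ᶠ[nhds 0] fun v => fderiv ℝ (localRep f t I) v (Pi.single i 1) := by
  have hd : ∀ᶠ v in nhds 0, ContDiffAt ℝ 1 (localRep f t I) v :=
    ((hf t I).of_le (by exact_mod_cast le_top)).eventually (by simp)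
  filter_upwards [hU t t.2 I, hd] with v hv hdv
  rw [localRep, extendZero_of_mem _ hv, ← (hdv.differentiableAt one_ne_zero).lineDeriv_eq_fderiv]
  refine congrArg (deriv · 0) (funext fun x => ?_)
  change _ = extendZero f _
  rw [displacement_add_smul_single, add_assoc]

theorem pd_eq_fderiv (hU : IsFinOpen U) {f : U → 𝕜} (hf : IsSmooth f) (t : U)
    (I : Finset ℕ+) (i : I) : pd i f t = fderiv ℝ (localRep f t I) 0 (Pi.single i 1) :=
  (localRep_zero (pd i f) t I).symm.trans (eventually_localRep_pd hU hf t I i).self_of_nhds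

theorem isSmooth_const (hU : IsFinOpen U) (c : 𝕜) : IsSmooth (fun _ : U => c) := fun t I => by
  refine (contDiffAt_const (c := c)).congr_of_eventuallyEq ?_
  filter_upwards [hU t t.2 I] with v hv
  exact extendZero_of_mem _ hv

theorem IsSmooth.add {f g : U → 𝕜} (hf : IsSmooth f) (hg : IsSmooth g) : IsSmooth (f + g) :=
  fun t I => by
    simp only [extendZero_add]
    exact (hf t I).add (hg t I)

theorem IsSmooth.mul {f g : U → 𝕜} (hf : IsSmooth f) (hg : IsSmooth g) : IsSmooth (f * g) :=
  fun t I => by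
    simp only [extendZero_mul]
    exact (hf t I).mul (hg t I)

theorem IsSmooth.inv {f : U → 𝕜} (hf : IsSmooth f) (h0 : ∀ t, f t ≠ 0) : IsSmooth f⁻¹ :=
  fun t I => by
    simp only [extendZero_inv]
    refine (hf t I).inv ?_
    have := localRep_zero f t I
    rw [localRep] at this
    rw [this]
    exact h0 t

theorem IsSmooth.pd (hU : IsFinOpen U) {f : U → 𝕜} (hf : IsSmooth f) (i : ℕ+) :
    IsSmooth (pd i f) := fun t I => by
  -- The derivative in `tᵢ` is visible only when `i` is among the chosen times; smoothness in `J` is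
  -- then restricted to `I` along the coordinate inclusion `ι`.
  set J := insert i I
  let ι : (I → ℝ) → (J → ℝ) := fun v j => displacement I v j
  have hι : ContDiff ℝ ∞ ι := by
    refine contDiff_pi.2 fun j => ?_
    change ContDiff ℝ ∞ fun v : I → ℝ => displacement I v j
    unfold displacement
    split_ifs with h
    · exact contDiff_apply ℝ ℝ _
    · exact contDiff_const
  have hι0 : ι 0 = 0 := by
    funext j
    simp only [ι, displacement_zero, Pi.zero_apply]
  have hdisp : ∀ v, displacement J (ι v) = displacement I v := fun v => by
    funext j
    by_cases hj : j ∈ J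
    · rw [displacement, dif_pos hj]
    · have hj' : j ∉ I := fun h => hj (Finset.mem_insert_of_mem h)
      rw [displacement, displacement, dif_neg hj, dif_neg hj']
  have h1 : ContDiffAt ℝ ∞ (localRep (DmKP.pd i f) t J) 0 := by
    refine ContDiffAt.congr_of_eventuallyEq ?_
      (eventually_localRep_pd hU hf t J ⟨i, Finset.mem_insert_self i I⟩)
    exact ((hf t J).fderiv_right (m := ∞) le_rfl).clm_apply contDiffAt_const
  have h2 := ContDiffAt.comp (g := localRep (DmKP.pd i f) t J) (f := ι) 0 (by rwa [hι0])
    hι.contDiffAt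
  simpa only [Function.comp_def, localRep, hdisp] using h2

theorem pd_add (hU : IsFinOpen U) {f g : U → 𝕜} (hf : IsSmooth f) (hg : IsSmooth g) (i : ℕ+) :
    pd i (f + g) = pd i f + pd i g := by
  funext t
  let j : ({i} : Finset ℕ+) := ⟨i, Finset.mem_singleton_self i⟩
  have h : localRep (f + g) t {i} = localRep f t {i} + localRep g t {i} :=
    funext fun v => extendZero_add f g _
  rw [Pi.add_apply, pd_eq_fderiv hU (hf.add hg) t {i} j, pd_eq_fderiv hU hf t {i} j,
    pd_eq_fderiv hU hg t {i} j, h, fderiv_add ((hf t _).differentiableAt (by simp))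
      ((hg t _).differentiableAt (by simp))]
  rfl

theorem pd_mul (hU : IsFinOpen U) {f g : U → 𝕜} (hf : IsSmooth f) (hg : IsSmooth g) (i : ℕ+) :
    pd i (f * g) = f * pd i g + g * pd i f := by
  funext t
  let j : ({i} : Finset ℕ+) := ⟨i, Finset.mem_singleton_self i⟩
  have h : localRep (f * g) t {i} = localRep f t {i} * localRep g t {i} :=
    funext fun v => extendZero_mul f g _
  have hf0 : extendZero f ((t : Times) + displacement {i} 0) = f t := localRep_zero f t {i}
  have hg0 : extendZero g ((t : Times) + displacement {i} 0) = g t := localRep_zero g t {i}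
  rw [Pi.add_apply, Pi.mul_apply, Pi.mul_apply, pd_eq_fderiv hU (hf.mul hg) t {i} j,
    pd_eq_fderiv hU hf t {i} j, pd_eq_fderiv hU hg t {i} j, h,
    fderiv_mul ((hf t _).differentiableAt (by simp)) ((hg t _).differentiableAt (by simp)),
    hf0, hg0]
  rfl

theorem pd_const (hU : IsFinOpen U) (c : 𝕜) (i : ℕ+) : pd i (fun _ : U => c) = 0 := by
  funext t
  let j : ({i} : Finset ℕ+) := ⟨i, Finset.mem_singleton_self i⟩
  have h : localRep (fun _ : U => c) t {i} =ᶠ[nhds 0] fun _ => c := by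
    filter_upwards [hU t t.2 {i}] with v hv
    exact extendZero_of_mem _ hv
  rw [pd_eq_fderiv hU (isSmooth_const hU c) t {i} j, h.fderiv_eq]
  simp

/-- Symmetry of the second derivative of the local representative in the two times `i` and `j`. -/
theorem pd_comm (hU : IsFinOpen U) {f : U → 𝕜} (hf : IsSmooth f) (i j : ℕ+) :
    pd i (pd j f) = pd j (pd i f) := by
  funext t
  let I : Finset ℕ+ := {i, j}
  have h : ∀ k l : I, pd k (pd l f) t =
      fderiv ℝ (fderiv ℝ (localRep f t I)) 0 (Pi.single k 1) (Pi.single l 1) := fun k l => by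
    have hd : DifferentiableAt ℝ (fderiv ℝ (localRep f t I)) 0 :=
      ((hf t I).fderiv_right (m := ∞) le_rfl).differentiableAt (by simp)
    rw [pd_eq_fderiv hU (hf.pd hU l) t I k, (eventually_localRep_pd hU hf t I l).fderiv_eq,
      fderiv_clm_apply hd (differentiableAt_const _)]
    simp
  have hs : IsSymmSndFDerivAt ℝ (localRep f t I) 0 :=
    ContDiffAt.isSymmSndFDerivAt (hf t I) (by
      rw [minSmoothness_of_isRCLikeNormedField]
      exact WithTop.coe_le_coe.2 (le_top : (2 : ℕ∞) ≤ ⊤))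
  have hi : i ∈ I := Finset.mem_insert_self i {j}
  have hj : j ∈ I := Finset.mem_insert_of_mem (Finset.mem_singleton_self j)
  exact ((h ⟨i, hi⟩ ⟨j, hj⟩).trans (hs _ _)).trans (h ⟨j, hj⟩ ⟨i, hi⟩).symm

end Smooth
end DmKP

/-! ### Iterated series as series in `s₁, s₃`, and transfer to the algebra of smooth functions. -/

namespace DmKP

open PowerSeries

section Join

variable {𝕜 : Type*} [CommRing 𝕜]

/-- The exponent `(a, b)` in two variables. -/
def pairExp (a b : ℕ) : Fin 2 →₀ ℕ := Finsupp.equivFunOnFinite.symm ![a, b]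

theorem exp_ext {d e : Fin 2 →₀ ℕ} : d = e ↔ d 0 = e 0 ∧ d 1 = e 1 := by
  rw [Finsupp.ext_iff, Fin.forall_fin_two]

/-- Iterated power series as power series in two variables; the inner variable is the first. -/
def joinFun (F : 𝕜⟦X⟧⟦X⟧) : MvPowerSeries (Fin 2) 𝕜 := fun d => coeff (d 0) (coeff (d 1) F)

theorem coeff_joinFun (F : 𝕜⟦X⟧⟦X⟧) (d : Fin 2 →₀ ℕ) :
    MvPowerSeries.coeff d (joinFun F) = coeff (d 0) (coeff (d 1) F) := rfl

theorem coeff_joinFun_mul (F G : 𝕜⟦X⟧⟦X⟧) (d : Fin 2 →₀ ℕ) :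
    MvPowerSeries.coeff d (joinFun (F * G)) = MvPowerSeries.coeff d (joinFun F * joinFun G) := by
  rw [MvPowerSeries.coeff_mul]
  simp only [coeff_joinFun]
  rw [coeff_mul, map_sum]
  simp only [coeff_mul]
  rw [Finset.sum_sigma']
  refine Finset.sum_nbij' (fun x => (pairExp x.2.1 x.1.1, pairExp x.2.2 x.1.2))
    (fun p => ⟨(p.1 1, p.2 1), (p.1 0, p.2 0)⟩) ?_ ?_ ?_ ?_ ?_
  · rintro ⟨⟨a, b⟩, ⟨c, e⟩⟩ h
    simp only [Finset.mem_sigma, Finset.HasAntidiagonal.mem_antidiagonal] at h ⊢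
    exact exp_ext.2 ⟨h.2, h.1⟩
  · rintro ⟨p, q⟩ h
    simp only [Finset.mem_sigma, Finset.HasAntidiagonal.mem_antidiagonal] at h ⊢
    rw [← h]
    exact ⟨rfl, rfl⟩
  · rintro ⟨⟨a, b⟩, ⟨c, e⟩⟩ h
    rfl
  · rintro ⟨p, q⟩ h
    exact Prod.ext (exp_ext.2 ⟨rfl, rfl⟩) (exp_ext.2 ⟨rfl, rfl⟩)
  · rintro ⟨⟨a, b⟩, ⟨c, e⟩⟩ h
    rfl

theorem coeff_joinFun_one (d : Fin 2 →₀ ℕ) :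
    MvPowerSeries.coeff d (joinFun (1 : 𝕜⟦X⟧⟦X⟧)) = MvPowerSeries.coeff d 1 := by
  classical
  rw [coeff_joinFun, MvPowerSeries.coeff_one, coeff_one]
  by_cases h : d 1 = 0
  · rw [if_pos h, coeff_one]
    simp [exp_ext, h]
  · simp [exp_ext, h]

/-- The ring homomorphism given by `joinFun`. -/
def join : 𝕜⟦X⟧⟦X⟧ →+* MvPowerSeries (Fin 2) 𝕜 where
  toFun := joinFun
  map_zero' := by
    ext d
    simp [coeff_joinFun]
  map_add' F G := by
    ext d
    rw [coeff_joinFun, map_add, map_add, map_add]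
    rfl
  map_one' := MvPowerSeries.ext coeff_joinFun_one
  map_mul' F G := MvPowerSeries.ext (coeff_joinFun_mul F G)

theorem join_apply (F : 𝕜⟦X⟧⟦X⟧) (d : Fin 2 →₀ ℕ) : join F d = coeff (d 0) (coeff (d 1) F) := rfl

theorem coeff_join (F : 𝕜⟦X⟧⟦X⟧) (d : Fin 2 →₀ ℕ) :
    MvPowerSeries.coeff d (join F) = coeff (d 0) (coeff (d 1) F) := rfl

theorem join_X : join (X : 𝕜⟦X⟧⟦X⟧) = MvPowerSeries.X 1 := by
  classical
  ext d
  rw [coeff_join, MvPowerSeries.coeff_X, coeff_X]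
  by_cases h : d 1 = 1
  · rw [if_pos h, coeff_one]
    simp [exp_ext, h]
  · simp [exp_ext, h]

theorem join_C_X : join (C X : 𝕜⟦X⟧⟦X⟧) = MvPowerSeries.X 0 := by
  classical
  ext d
  rw [coeff_join, MvPowerSeries.coeff_X, coeff_C]
  by_cases h : d 1 = 0
  · rw [if_pos h, coeff_X]
    simp [exp_ext, h]
  · simp [exp_ext, h]

end Join

section Transfer

variable {𝕜 : Type*} [RCLike 𝕜] {U : Set Times}

/-- The algebra of smooth functions of the times. -/
def smoothAlgebra (𝕜 : Type*) [RCLike 𝕜] {U : Set Times} (hU : IsFinOpen U) :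
    Subalgebra 𝕜 (U → 𝕜) where
  carrier := {f | IsSmooth f}
  mul_mem' := IsSmooth.mul
  add_mem' := IsSmooth.add
  algebraMap_mem' c := isSmooth_const hU c

variable (hU : IsFinOpen U)

/-- The derivation `∂/∂tᵢ₊₁` of the smooth functions. -/
def pdDerivation (𝕜 : Type*) [RCLike 𝕜] {U : Set Times} (hU : IsFinOpen U) (i : ℕ) : Derivation 𝕜 (smoothAlgebra 𝕜 hU) (smoothAlgebra 𝕜 hU) :=
  Derivation.mk'
    { toFun := fun f => ⟨pd i.succPNat f, f.2.pd hU _⟩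
      map_add' := fun f g => Subtype.ext (pd_add hU f.2 g.2 _)
      map_smul' := fun c f => Subtype.ext (by
        have h : ((c • f : smoothAlgebra 𝕜 hU) : U → 𝕜) = (fun _ => c) * (f : U → 𝕜) := rfl
        change pd _ ((c • f : smoothAlgebra 𝕜 hU) : U → 𝕜) = _
        rw [h, pd_mul hU (isSmooth_const hU c) f.2, pd_const hU, mul_zero, add_zero]
        rfl) }
    fun f g => Subtype.ext (pd_mul hU f.2 g.2 _)

theorem pdDerivation_comm (i j : ℕ) (f : smoothAlgebra 𝕜 hU) :
    pdDerivation 𝕜 hU i (pdDerivation 𝕜 hU j f) = pdDerivation 𝕜 hU j (pdDerivation 𝕜 hU i f) :=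
  Subtype.ext (pd_comm hU f.2 _ _)

/-- The formal shift `f ↦ f(t + ε[s])` of smooth functions. -/
abbrev timeShift (𝕜 : Type*) [RCLike 𝕜] {U : Set Times} (hU : IsFinOpen U) (ε : 𝕜) :
    smoothAlgebra 𝕜 hU →+* (smoothAlgebra 𝕜 hU)⟦X⟧ :=
  shiftHom (pdDerivation 𝕜 hU) (pdDerivation_comm hU) ε

theorem isUnit_smooth {f : U → 𝕜} (hf : IsSmooth f) (h0 : ∀ t, f t ≠ 0) :
    IsUnit (⟨f, hf⟩ : smoothAlgebra 𝕜 hU) :=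
  IsUnit.of_mul_eq_one ⟨f⁻¹, hf.inv h0⟩
    (Subtype.ext (funext fun t => mul_inv_cancel₀ (h0 t)))

theorem coe_coeff_miwaSeries_pow (f : smoothAlgebra 𝕜 hU) (m k : ℕ) :
    ((coeff k (miwaSeries (pdDerivation 𝕜 hU) ^ m) f : smoothAlgebra 𝕜 hU) : U → 𝕜) =
      (miwaField^[m] (Pi.single 0 (f : U → 𝕜))) k := by
  induction m generalizing k with
  | zero =>
    rw [pow_zero, coeff_one, Function.iterate_zero, id]
    rcases k with _ | k
    · simp
    · rw [if_neg k.succ_ne_zero, Pi.single_eq_of_ne k.succ_ne_zero]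
      rfl
  | succ m ih =>
    rw [pow_succ', coeff_fieldSeries_mul, Function.iterate_succ_apply', miwaField,
      AddSubmonoidClass.coe_finsetSum]
    refine Finset.sum_congr rfl fun i _ => ?_
    rw [← ih]
    rfl

/-- The abstract shift gives the formal Taylor expansion. -/
theorem coe_coeff_shiftHom (ε : ℤ) (k : ℕ) (f : smoothAlgebra 𝕜 hU) :
    ((coeff k (timeShift 𝕜 hU (ε : 𝕜) f) : smoothAlgebra 𝕜 hU) : U → 𝕜) =
      miwaCoeff ε k (f : U → 𝕜) := by
  rw [coeff_shiftHom, coeff_shiftSeries, miwaCoeff, LinearMap.sum_apply,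
    AddSubmonoidClass.coe_finsetSum]
  refine Finset.sum_congr rfl fun m _ => ?_
  rw [← coe_coeff_miwaSeries_pow]
  rfl

theorem miwaCoeff_zero (k : ℕ) (f : U → 𝕜) : miwaCoeff 0 k f = if k = 0 then f else 0 := by
  rw [miwaCoeff, Finset.sum_range_succ', Finset.sum_eq_zero]
  · rcases k with _ | k <;> simp
  · intro m _
    simp

/-- The operators with smooth coefficients. -/
def liftOp (a : PsDiff (U → 𝕜)) (ha : ∀ k n, IsSmooth (a.coeff k n)) :
    PsDiff (smoothAlgebra 𝕜 hU) where
  coeff k n := ⟨a.coeff k n, ha k n⟩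
  bounded := by
    obtain ⟨K, hK⟩ := a.bounded
    exact ⟨K, fun k hk => funext fun n => Subtype.ext (congrFun (hK k hk) n)⟩

/-- The inclusion of the smooth functions. -/
abbrev incl : smoothAlgebra 𝕜 hU →+* (U → 𝕜) := (smoothAlgebra 𝕜 hU).val

/-- Lets operator identities over all functions of `t` be pulled back to smooth coefficients, where
the `∂ᵢ` are derivations. -/
theorem mapCoeff_incl_injective :
    Function.Injective (PsDiff.mapCoeff (incl (𝕜 := 𝕜) hU : smoothAlgebra 𝕜 hU →+ (U → 𝕜))) :=
  fun a b h => by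
    ext1
    funext k n
    exact Subtype.ext (congrFun (congrFun (congrArg PsDiff.coeff h) k) n)

theorem mapCoeff_incl_liftOp (a : PsDiff (U → 𝕜)) (ha : ∀ k n, IsSmooth (a.coeff k n)) :
    PsDiff.mapCoeff (incl (𝕜 := 𝕜) hU : smoothAlgebra 𝕜 hU →+ (U → 𝕜)) (liftOp hU a ha) = a := rfl

/-- Smoothness is assumed for `Z` only; the inverse inherits it because its coefficients are
computed recursively from those of `Z` and from `1 / z₀`. -/
theorem Solution.isSmooth_Zinv (hU : IsFinOpen U) (S : Solution 𝕜 U) (k n : ℤ) :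
    IsSmooth (S.Zinv.coeff k n) :=
  PsDiff.coeff_mem_of_mul_eq_one (R := (smoothAlgebra 𝕜 hU).toSubring) S.order_le S.smooth
    (fun n => ⟨(S.Z.coeff 0 n)⁻¹, (S.smooth 0 n).inv (S.lead_ne_zero n),
      funext fun t => inv_mul_cancel₀ (S.lead_ne_zero n t)⟩) S.mul_inv k n

theorem mapCoeff_neg {A B : Type*} [CommRing A] [CommRing B] (f : A →+ B) (a : PsDiff A) :
    PsDiff.mapCoeff f (-a) = -PsDiff.mapCoeff f a := by
  ext m n
  exact map_neg f _

theorem Solution.lift_sato (S : Solution 𝕜 U) (i : ℕ) :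
    PsDiff.mapCoeff (pdDerivation 𝕜 hU i : smoothAlgebra 𝕜 hU →+ smoothAlgebra 𝕜 hU)
        (liftOp hU S.Z S.smooth) =
      -((npowRec (i + 1) (liftOp hU S.Z S.smooth * PsDiff.deltaPow 1 *
        liftOp hU S.Zinv (S.isSmooth_Zinv hU))).nonpos * liftOp hU S.Z S.smooth) := by
  apply mapCoeff_incl_injective hU
  rw [mapCoeff_neg, PsDiff.mapCoeff_mul, PsDiff.mapCoeff_nonpos, PsDiff.mapCoeff_npowRec,
    PsDiff.mapCoeff_mul, PsDiff.mapCoeff_mul, PsDiff.mapCoeff_deltaPow, mapCoeff_incl_liftOp,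
    mapCoeff_incl_liftOp]
  ext k n t
  exact S.sato i.succPNat k n t

theorem Solution.lift_inv_mul (S : Solution 𝕜 U) :
    liftOp hU S.Zinv (S.isSmooth_Zinv hU) * liftOp hU S.Z S.smooth = 1 := by
  apply mapCoeff_incl_injective hU
  rw [PsDiff.mapCoeff_mul, mapCoeff_incl_liftOp, mapCoeff_incl_liftOp, S.inv_mul]
  exact (PsDiff.mapCoeff_deltaPow (incl (𝕜 := 𝕜) hU) 0).symm

/-- The tau functions as elements of the algebra of smooth functions. -/
abbrev liftTau {τ : Fin 2 → ℤ → U → 𝕜} (hτ : ∀ i n, IsSmooth (τ i n)) (i : Fin 2) (n : ℤ) :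
    smoothAlgebra 𝕜 hU := ⟨τ i n, hτ i n⟩

theorem Solution.IsTau.negFay {S : Solution 𝕜 U} {τ : Fin 2 → ℤ → U → 𝕜} (hτ : S.IsTau τ)
    (i : Fin 2) (n : ℤ) :
    NegFay (timeShift 𝕜 hU (-1 : 𝕜))
      (liftTau hU hτ.smooth i) n := by
  set T := timeShift 𝕜 hU (-1 : 𝕜)
  set Z := liftOp hU S.Z S.smooth
  have hunit : ∀ i n, IsUnit (liftTau hU hτ.smooth i n) := fun i n =>
    isUnit_smooth hU (hτ.smooth i n) (hτ.ne_zero i n)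
  have hT : ∀ f, coeff 0 (T f) = f := coeff_zero_shiftHom _ _ _
  let W : ℤ → (smoothAlgebra 𝕜 hU)⟦X⟧ := fun n => PowerSeries.mk fun j => Z.coeff (-(j : ℤ)) n
  obtain ⟨e, he⟩ := exists_shift_wave_eq (pdDerivation 𝕜 hU) (pdDerivation_comm hU)
    (Z := Z) (W := W)
    (fun k hk => funext fun n => Subtype.ext (congrFun (S.order_le k hk) n))
    (fun n => isUnit_smooth hU (S.smooth 0 n) (S.lead_ne_zero n))
    (S.lift_inv_mul hU) (S.lift_sato hU) (fun n j => coeff_mk _ _)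
  have hW : ∀ n, W n * C (liftTau hU hτ.smooth 1 n) = T (liftTau hU hτ.smooth 0 n) := fun n => by
    ext1 j
    rw [coeff_mul_C, coeff_mk]
    refine Subtype.ext (funext fun t => ?_)
    have h := coe_coeff_shiftHom hU (-1) j (liftTau hU hτ.smooth 0 n)
    rw [Int.cast_neg, Int.cast_one] at h
    rw [h]
    exact (div_eq_iff (hτ.ne_zero 1 n t)).1 (hτ.wave_eq j n t).symm |>.symm
  have h0 : ∀ n, NegFay T (liftTau hU hτ.smooth 0) n :=
    negFay_zero hT (hunit 0) (hunit 1) hW he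
  have hB := fun n => (tau_site_relation hT (hunit 0) (hunit 1) hW he n).2
  fin_cases i
  · exact h0 n
  -- The relation at site `n + 1` requires the identity for `τ₀` there, hence the use of `h0` and
  -- `hB` at both sites.
  · exact negFay_one (hunit 0) (hB n) (h0 n)
      (tauRelation_of_negFay (hunit 0 _) (hB (n + 1)) (h0 (n + 1)))

theorem mvPowerSeries_X_ne_zero (i : Fin 2) : (MvPowerSeries.X i : MvPowerSeries (Fin 2) 𝕜) ≠ 0 :=
  fun h => one_ne_zero (α := 𝕜) (by
    rw [← MvPowerSeries.coeff_index_single_self_X i, h, map_zero])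

/-- Evaluation of the coefficients at a point. -/
def evalJoin (t : U) : (smoothAlgebra 𝕜 hU)⟦X⟧⟦X⟧ →+* MvPowerSeries (Fin 2) 𝕜 :=
  join.comp (PowerSeries.map (PowerSeries.map ((Pi.evalRingHom (fun _ : U => 𝕜) t).comp (incl hU))))

theorem evalJoin_apply (t : U) (F : (smoothAlgebra 𝕜 hU)⟦X⟧⟦X⟧) (d : Fin 2 →₀ ℕ) :
    evalJoin hU t F d = ((coeff (d 0) (coeff (d 1) F) : smoothAlgebra 𝕜 hU) : U → 𝕜) t := by
  rw [evalJoin, RingHom.comp_apply, join_apply, coeff_map, coeff_map]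
  rfl

theorem algebraMap_evalJoin_shift (a b : ℤ) {f : ℤ → U → 𝕜} (hf : ∀ n, IsSmooth (f n)) (t : U)
    (n : ℤ) : algebraMap (MvPowerSeries (Fin 2) 𝕜) (MiwaField 𝕜)
      (evalJoin hU t (PowerSeries.map (timeShift 𝕜 hU (a : 𝕜))
        (timeShift 𝕜 hU (b : 𝕜) ⟨f n, hf n⟩))) =
      shifted a b f t n := by
  rw [shifted]
  congr 1
  funext d
  rw [evalJoin_apply, coeff_map, coe_coeff_shiftHom, coe_coeff_shiftHom]

theorem shiftHom_zero (f : smoothAlgebra 𝕜 hU) :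
    timeShift 𝕜 hU ((0 : ℤ) : 𝕜) f = C f := by
  ext1 k
  refine Subtype.ext ?_
  rw [coe_coeff_shiftHom, miwaCoeff_zero, coeff_C]
  split_ifs <;> rfl

/-- Its constant coefficient is `f n t`. -/
theorem shifted_zero_zero_ne_zero {f : ℤ → U → 𝕜} {t : U} {n : ℤ} (h : f n t ≠ 0) :
    shifted 0 0 f t n ≠ 0 := by
  intro h0
  refine h ?_
  have := congrFun ((FaithfulSMul.algebraMap_eq_zero_iff (MvPowerSeries (Fin 2) 𝕜) (MiwaField 𝕜)).1 h0) 0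
  rwa [miwaCoeff_zero, miwaCoeff_zero, Finsupp.coe_zero, Pi.zero_apply, Pi.zero_apply, if_pos rfl,
    if_pos rfl] at this

theorem fay_shifted (hU : IsFinOpen U) {S : Solution 𝕜 U} {τ : Fin 2 → ℤ → U → 𝕜} (hτ : S.IsTau τ)
    (i : Fin 2) (n : ℤ) (t : U) :
    (s₃ 𝕜 - s₁ 𝕜) * shifted 0 (-1) (τ i) t n * shifted 1 0 (τ i) t (n + 1) =
      (1 + s₁ 𝕜) * s₃ 𝕜 * shifted 0 0 (τ i) t (n + 1) * shifted 1 (-1) (τ i) t n -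
        s₁ 𝕜 * (1 + s₃ 𝕜) * shifted 0 0 (τ i) t n * shifted 1 (-1) (τ i) t (n + 1) := by
  -- Reading the constant embedding `C` as the zero shift brings all terms to the form `shifted a
  -- b`.
  have hC : timeShift 𝕜 hU ((0 : ℤ) : 𝕜) = C := RingHom.ext (shiftHom_zero hU)
  have h := fay_of_negFay (T' := timeShift 𝕜 hU (1 : 𝕜))
    (diag_map_shiftHom _ _ 1) (hτ.negFay hU i n)
  have h := congrArg (fun F => algebraMap (MvPowerSeries (Fin 2) 𝕜) (MiwaField 𝕜)
    (evalJoin hU t F)) h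
  have hX : algebraMap (MvPowerSeries (Fin 2) 𝕜) (MiwaField 𝕜) (evalJoin hU t X) = s₃ 𝕜 := by
    rw [evalJoin, RingHom.comp_apply, PowerSeries.map_X, join_X, s₃]
  have hCX : algebraMap (MvPowerSeries (Fin 2) 𝕜) (MiwaField 𝕜) (evalJoin hU t (C X)) = s₁ 𝕜 := by
    rw [evalJoin, RingHom.comp_apply, PowerSeries.map_C, PowerSeries.map_X, join_C_X, s₁]
  simp only [map_mul, map_sub, map_add, map_one, hX, hCX] at h
  have e := fun a b => algebraMap_evalJoin_shift hU a b (hτ.smooth i) t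
  have e00 := e 0 0
  have e01 := e 0 (-1)
  have e10 := e 1 0
  have e11 := e 1 (-1)
  simp only [hC, Int.cast_neg, Int.cast_one, PowerSeries.map_C] at e00 e01 e10 e11
  rw [← e00, ← e00, ← e01, ← e10, ← e11, ← e11]
  exact h

end Transfer

end DmKP

end

theorem proposition3p2 {𝕜 : Type*} [RCLike 𝕜] (U : Set DmKP.Times) (hU : DmKP.IsFinOpen U)
    (S : DmKP.Solution 𝕜 U) (τ : Fin 2 → ℤ → U → 𝕜) (hτ : S.IsTau τ)
    (i : Fin 2) (n : ℤ) (t : U) :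
    (1 + (DmKP.s₃ 𝕜)⁻¹) *
        fwdDiff (1 : ℤ)
          (fun m => DmKP.shifted 1 (-1) (τ i) t m / DmKP.shifted 0 0 (τ i) t m) n =
      ((DmKP.s₃ 𝕜)⁻¹ - (DmKP.s₁ 𝕜)⁻¹) *
        (DmKP.shifted 0 (-1) (τ i) t n * DmKP.shifted 1 0 (τ i) t (n + 1) /
            (DmKP.shifted 0 0 (τ i) t n * DmKP.shifted 0 0 (τ i) t (n + 1)) -
          DmKP.shifted 1 (-1) (τ i) t n / DmKP.shifted 0 0 (τ i) t n) := by
  have h := DmKP.fay_shifted hU hτ i n t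
  have h1 : DmKP.s₁ 𝕜 ≠ 0 := by
    rw [DmKP.s₁, Ne, FaithfulSMul.algebraMap_eq_zero_iff]
    exact DmKP.mvPowerSeries_X_ne_zero _
  have h3 : DmKP.s₃ 𝕜 ≠ 0 := by
    rw [DmKP.s₃, Ne, FaithfulSMul.algebraMap_eq_zero_iff]
    exact DmKP.mvPowerSeries_X_ne_zero _
  have hp := DmKP.shifted_zero_zero_ne_zero (hτ.ne_zero i n t)
  have hq := DmKP.shifted_zero_zero_ne_zero (hτ.ne_zero i (n + 1) t)
  rw [fwdDiff]
  -- Multiplication by `s₁ s₃ τ(n) τ(n+1)` turns the goal into a rearrangement of the polynomial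
  -- identity `h`.
  field_simp
  linear_combination h
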